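/- Let $g:\mathbb{R}^{d_x}\times\mathbb{R}^{d_y}\to\mathbb{R}$, $p:\mathbb{R}^{d_x}\times\mathbb{R}^{d_y}\to\mathbb{R}^m$ and $q:\mathbb{R}^{d_x}\times\mathbb{R}^{d_y}\to\mathbb{R}^n$ be twice continuously differentiable, and for $x\in\mathbb{R}^{d_x}$ let $P(x)$ be the problem of minimizing $g(x,y)$ over $K(x)=\{y\in\mathbb{R}^{d_y}: p(x,y)\le 0,\ q(x,y)=0\}$. Let $\mu>0$ and suppose that for every $x$: $g(x,\cdot)$ is $\mu$-strongly convex, each $p_j(x,\cdot)$ is convex, each $q_i(x,\cdot)$ is affine, $K(x)\neq\emptyset$, and LICQ holds at every global minimum $y$ of $P(x)$, i.e. the family $\nabla_y p_j(x,y)$ ($j$ with $p_j(x,y)=0$), $\nabla_y q_i(x,y)$ ($1\le i\le n$) is linearly independent. Put $\mathcal{L}(y,\lambda,\nu,x)=g(x,y)+\lambda^\top p(x,y)+\nu^\top q(x,y)$. The KKT conditions hold at $y$ with multipliers $(\lambda,\nu)$ if $\nabla_y\mathcal{L}=0$, $p(x,y)\le0$, $q(x,y)=0$, $\lambda\ge0$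 and $\lambda_jp_j(x,y)=0$ for all $j$. Then: (i) For every $x$, $P(x)$ has a unique global minimum $y^*(x)$, and the KKT conditions hold at $y^*(x)$ with unique multipliers $\lambda(x)$, $\nu(x)$. (ii) The map $z(x)=(y^*(x),\lambda(x),\nu(x))$ is continuous and locally Lipschitz. For $x,d\in\mathbb{R}^{d_x}$ let $J(x)=\{j:p_j(x,y^*(x))=0\}$, $J^+(x)=\{j\in J(x):\lambda_j(x)>0\}$, $J^0(x)=J(x)\setminus J^+(x)$; let $J^0_+(x,d)$ be the set of $j\in J^0(x)$ for which there is $\epsilon_0>0$ such that $p_j(x+\epsilon d,y^*(x+\epsilon d))=0$ and $\lambda_j(x+\epsilon d)>0$ for all $0<\epsilon<\epsilon_0$; and let $J^0_-(x,d)=J^0(x)\setminus J^0_+(x,d)$. For $S\subseteq\{1,\dots,m\}$ let $$M_S(x)=\begin{bmatrix}\nabla_y^2\mathcal{L}&\nabla_yp_S^\top&\nabla_yq^\top\\ \nabla_yp_S&0&0\\ \nabla_yq&0&0\end{bmatrix},\qquad N_S(x)=\begin{bmatrix}\nabla^2_{xy}\mathcal{L}\\ \nabla_xp_S\\ \nabla_xq\end{bmatrix},$$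 evaluated at $x,\ y^*(x),\ \lambda(x),\ \nu(x)$, where $\nabla_y p_S,\nabla_y q,\nabla_x p_S,\nabla_x q$ are Jacobians and $\nabla^2_{xy}\mathcal{L}$ is the $d_y\times d_x$ Jacobian in $x$ of $\nabla_y\mathcal{L}$. (iii) For all $x,d\in\mathbb{R}^{d_x}$ (in particular for all unit vectors $d$), the directional derivative $\nabla_dz(x)=\lim_{h\to0^+}\frac{z(x+hd)-z(x)}{h}$ exists. With $S=J^+(x)\cup J^0_+(x,d)$ the matrix $M_S(x)$ is nonsingular, $$\begin{bmatrix}\nabla_dy^*(x)\\ \nabla_d\lambda_S(x)\\ \nabla_d\nu(x)\end{bmatrix}=-M_S(x)^{-1}N_S(x)\,d,$$ and $\nabla_d\lambda_j(x)=0$ for $j\in J^0_-(x,d)$ and for $j\notin J(x)$. (iv) If $x$ is such that $\lambda_j(x)>0$ for all $j\in J(x)$ (strict complementarity), then $z$ is continuously differentiable at $x$ (that is, $C^1$ in a neighbourhood of $x$), $J(x)=J^+(x)$, the matrix $M_{J^+(x)}(x)$ is nonsingular, the Jacobian at $x$ of $(y^*,\lambda_{J(x)},\nu)$ equals $-M_{J^+(x)}(x)^{-1}N_{J^+(x)}(x)$,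 and the derivative of $\lambda_j$ at $x$ is $0$ for $j\notin J(x)$. -/

import Mathlib

open scoped Gradient

noncomputable section

/-- The data of a parametric program `P(x)`: minimise `g(x, y)` over `y ∈ ℝ^dy` subject to
`p_j(x, y) ≤ 0` (`1 ≤ j ≤ m`) and `q_i(x, y) = 0` (`1 ≤ i ≤ n`), with parameter `x ∈ ℝ^dx`. -/
structure ParamProgram (dx dy m n : ℕ) where
  /-- the objective -/
  g : EuclideanSpace ℝ (Fin dx) → EuclideanSpace ℝ (Fin dy) → ℝ
  /-- the inequality constraints -/
  p : Fin m → EuclideanSpace ℝ (Fin dx) → EuclideanSpace ℝ (Fin dy) → ℝ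
  /-- the equality constraints -/
  q : Fin n → EuclideanSpace ℝ (Fin dx) → EuclideanSpace ℝ (Fin dy) → ℝ

namespace ParamProgram

variable {dx dy m n : ℕ} (P : ParamProgram dx dy m n)

/-- The objective and all the constraints are twice continuously differentiable, jointly in
`(x, y)`. -/
def IsC2 : Prop :=
  ContDiff ℝ 2 (fun w : EuclideanSpace ℝ (Fin dx) × EuclideanSpace ℝ (Fin dy) => P.g w.1 w.2) ∧
  (∀ j, ContDiff ℝ 2
    (fun w : EuclideanSpace ℝ (Fin dx) × EuclideanSpace ℝ (Fin dy) => P.p j w.1 w.2)) ∧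
  (∀ i, ContDiff ℝ 2
    (fun w : EuclideanSpace ℝ (Fin dx) × EuclideanSpace ℝ (Fin dy) => P.q i w.1 w.2))

/-- For every `x`: `g(x, ·)` is `μ`-strongly convex, each `p_j(x, ·)` is convex and each
`q_i(x, ·)` is affine. -/
def IsStronglyConvexProgram (μ : ℝ) : Prop :=
  ∀ x, StrongConvexOn Set.univ μ (P.g x) ∧
    (∀ j, ConvexOn ℝ Set.univ (P.p j x)) ∧
    (∀ i, ∃ A : EuclideanSpace ℝ (Fin dy) →ᵃ[ℝ] ℝ, ∀ y, P.q i x y = A y)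

/-- The feasible set `K(x)`. -/
def feasible (x : EuclideanSpace ℝ (Fin dx)) : Set (EuclideanSpace ℝ (Fin dy)) :=
  {y | (∀ j, P.p j x y ≤ 0) ∧ (∀ i, P.q i x y = 0)}

/-- `y` is a global minimum of `P(x)`. -/
def IsSolution (x : EuclideanSpace ℝ (Fin dx)) (y : EuclideanSpace ℝ (Fin dy)) : Prop :=
  y ∈ P.feasible x ∧ ∀ y' ∈ P.feasible x, P.g x y ≤ P.g x y'

/-- The Lagrangian `L(y, lam, nu, x) = g(x, y) + lamᵀ p(x, y) + nuᵀ q(x, y)`. -/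
def lagrangian (x : EuclideanSpace ℝ (Fin dx)) (y : EuclideanSpace ℝ (Fin dy))
    (lam : EuclideanSpace ℝ (Fin m)) (nu : EuclideanSpace ℝ (Fin n)) : ℝ :=
  P.g x y + ∑ j, lam j * P.p j x y + ∑ i, nu i * P.q i x y

/-- The gradient `∇_y L` of the Lagrangian in `y`. -/
def gradLagrangian (x : EuclideanSpace ℝ (Fin dx)) (y : EuclideanSpace ℝ (Fin dy))
    (lam : EuclideanSpace ℝ (Fin m)) (nu : EuclideanSpace ℝ (Fin n)) :
    EuclideanSpace ℝ (Fin dy) :=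
  ∇ (fun y' => P.lagrangian x y' lam nu) y

/-- The KKT conditions for `P(x)` hold at `y` with the multipliers `lam`, `nu`. -/
def IsKKT (x : EuclideanSpace ℝ (Fin dx)) (y : EuclideanSpace ℝ (Fin dy))
    (lam : EuclideanSpace ℝ (Fin m)) (nu : EuclideanSpace ℝ (Fin n)) : Prop :=
  P.gradLagrangian x y lam nu = 0 ∧
  (∀ j, P.p j x y ≤ 0) ∧ (∀ i, P.q i x y = 0) ∧
  (∀ j, 0 ≤ lam j) ∧ (∀ j, lam j * P.p j x y = 0)

open Classical in
/-- The active inequality constraints `J(x, y)`. -/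
def active (x : EuclideanSpace ℝ (Fin dx)) (y : EuclideanSpace ℝ (Fin dy)) : Finset (Fin m) :=
  Finset.univ.filter fun j => P.p j x y = 0

/-- The linear independence constraint qualification at `y` for `P(x)`. -/
def LICQ (x : EuclideanSpace ℝ (Fin dx)) (y : EuclideanSpace ℝ (Fin dy)) : Prop :=
  LinearIndependent ℝ
    (Sum.elim (fun j : P.active x y => ∇ (P.p j x) y) (fun i : Fin n => ∇ (P.q i x) y))

open Classical in
/-- The strictly active inequality constraints `J⁺(x, y, lam)`. -/
def strictlyActive (x : EuclideanSpace ℝ (Fin dx)) (y : EuclideanSpace ℝ (Fin dy))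
    (lam : EuclideanSpace ℝ (Fin m)) : Finset (Fin m) :=
  (P.active x y).filter fun j => 0 < lam j

/-- The non-strictly active inequality constraints `J⁰(x, y, lam) = J \ J⁺`. -/
def weaklyActive (x : EuclideanSpace ℝ (Fin dx)) (y : EuclideanSpace ℝ (Fin dy))
    (lam : EuclideanSpace ℝ (Fin m)) : Finset (Fin m) :=
  P.active x y \ P.strictlyActive x y lam

/-- Strict complementarity slackness at `y` with respect to `lam`. -/
def SCSC (x : EuclideanSpace ℝ (Fin dx)) (y : EuclideanSpace ℝ (Fin dy))
    (lam : EuclideanSpace ℝ (Fin m)) : Prop :=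
  ∀ j ∈ P.active x y, 0 < lam j

open Classical in
/-- `J⁰₊(x, d)` along the solution path `ystar` with multipliers `lam`: those `j ∈ J⁰` for which
`p_j = 0` and `lam_j > 0` at all the points `x + ε d` with `ε > 0` small. -/
def weaklyActivePos (ystar : EuclideanSpace ℝ (Fin dx) → EuclideanSpace ℝ (Fin dy))
    (lam : EuclideanSpace ℝ (Fin dx) → EuclideanSpace ℝ (Fin m))
    (x d : EuclideanSpace ℝ (Fin dx)) : Finset (Fin m) :=
  (P.weaklyActive x (ystar x) (lam x)).filter fun j =>
    ∃ ε₀ : ℝ, 0 < ε₀ ∧ ∀ ε : ℝ, 0 < ε → ε < ε₀ →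
      P.p j (x + ε • d) (ystar (x + ε • d)) = 0 ∧ 0 < lam (x + ε • d) j

/-- `J⁰₋(x, d) = J⁰ \ J⁰₊(x, d)`. -/
def weaklyActiveNeg (ystar : EuclideanSpace ℝ (Fin dx) → EuclideanSpace ℝ (Fin dy))
    (lam : EuclideanSpace ℝ (Fin dx) → EuclideanSpace ℝ (Fin m))
    (x d : EuclideanSpace ℝ (Fin dx)) : Finset (Fin m) :=
  P.weaklyActive x (ystar x) (lam x) \ P.weaklyActivePos ystar lam x d

/-- The Hessian `∇²_y L`, a `dy × dy` matrix. -/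
def hessYY (x : EuclideanSpace ℝ (Fin dx)) (y : EuclideanSpace ℝ (Fin dy))
    (lam : EuclideanSpace ℝ (Fin m)) (nu : EuclideanSpace ℝ (Fin n)) :
    Matrix (Fin dy) (Fin dy) ℝ :=
  Matrix.of fun i k =>
    (fderiv ℝ (fun y' => P.gradLagrangian x y' lam nu) y (EuclideanSpace.single k 1)) i

/-- The mixed second derivative `∇²_{xy} L`, i.e. the `dy × dx` Jacobian in `x` of `∇_y L`. -/
def hessXY (x : EuclideanSpace ℝ (Fin dx)) (y : EuclideanSpace ℝ (Fin dy))
    (lam : EuclideanSpace ℝ (Fin m)) (nu : EuclideanSpace ℝ (Fin n)) :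
    Matrix (Fin dy) (Fin dx) ℝ :=
  Matrix.of fun i k =>
    (fderiv ℝ (fun x' => P.gradLagrangian x' y lam nu) x (EuclideanSpace.single k 1)) i

/-- The Jacobian in `y` of `(p_S, q)`. -/
def jacY (S : Finset (Fin m)) (x : EuclideanSpace ℝ (Fin dx)) (y : EuclideanSpace ℝ (Fin dy)) :
    Matrix (S ⊕ Fin n) (Fin dy) ℝ :=
  Matrix.fromRows (Matrix.of fun (j : S) k => (∇ (P.p j x) y) k)
    (Matrix.of fun i k => (∇ (P.q i x) y) k)

/-- The Jacobian in `x` of `(p_S, q)`. -/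
def jacX (S : Finset (Fin m)) (x : EuclideanSpace ℝ (Fin dx)) (y : EuclideanSpace ℝ (Fin dy)) :
    Matrix (S ⊕ Fin n) (Fin dx) ℝ :=
  Matrix.fromRows (Matrix.of fun (j : S) k => (∇ (fun x' => P.p j x' y) x) k)
    (Matrix.of fun i k => (∇ (fun x' => P.q i x' y) x) k)

/-- The reduced KKT matrix over the set `S` of inequality constraints,
`[∇²_y L, ∇_y p_Sᵀ, ∇_y qᵀ; ∇_y p_S, 0, 0; ∇_y q, 0, 0]`. -/
def kktM (S : Finset (Fin m)) (x : EuclideanSpace ℝ (Fin dx)) (y : EuclideanSpace ℝ (Fin dy))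
    (lam : EuclideanSpace ℝ (Fin m)) (nu : EuclideanSpace ℝ (Fin n)) :
    Matrix (Fin dy ⊕ (S ⊕ Fin n)) (Fin dy ⊕ (S ⊕ Fin n)) ℝ :=
  Matrix.fromBlocks (P.hessYY x y lam nu) (P.jacY S x y).transpose (P.jacY S x y) 0

/-- The right-hand side matrix `[∇²_{xy} L; ∇_x p_S; ∇_x q]` over the set `S`. -/
def kktN (S : Finset (Fin m)) (x : EuclideanSpace ℝ (Fin dx)) (y : EuclideanSpace ℝ (Fin dy))
    (lam : EuclideanSpace ℝ (Fin m)) (nu : EuclideanSpace ℝ (Fin n)) :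
    Matrix (Fin dy ⊕ (S ⊕ Fin n)) (Fin dx) ℝ :=
  Matrix.fromRows (P.hessXY x y lam nu) (P.jacX S x y)

end ParamProgram

/-- The stacked vector `(u, l_S, v)` made from `(u, l, v) ∈ ℝ^dy × ℝ^m × ℝ^n`. -/
def reducedVec {dy m n : ℕ} (S : Finset (Fin m))
    (w : EuclideanSpace ℝ (Fin dy) × EuclideanSpace ℝ (Fin m) × EuclideanSpace ℝ (Fin n)) :
    Fin dy ⊕ (S ⊕ Fin n) → ℝ :=
  Sum.elim (fun k => w.1 k) (Sum.elim (fun j : S => w.2.1 j) (fun i => w.2.2 i))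

/-- `v` is the one-sided directional derivative `lim_{h → 0⁺} (F (x + h d) - F x) / h`. -/
def HasDirDeriv {X Y : Type*} [NormedAddCommGroup X] [NormedSpace ℝ X]
    [NormedAddCommGroup Y] [NormedSpace ℝ Y] (F : X → Y) (x d : X) (v : Y) : Prop :=
  Filter.Tendsto (fun h : ℝ => h⁻¹ • (F (x + h • d) - F x)) (nhdsWithin 0 (Set.Ioi 0)) (nhds v)

end

/-! For multipliers with `lam ≥ 0` the Lagrangian is itself `μ`-strongly convex in `y`, since the
equality constraints are affine. So a KKT point satisfies quadratic growth on the feasible set,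
which gives uniqueness of the minimiser; coercivity gives existence. LICQ plays two roles. Slopes
against the active gradients can be prescribed at will, which produces a descent direction whenever
the KKT conditions fail. And the multiplier map `(lam, nu) ↦ ∑ lam_j ∇p_j + ∑ nu_i ∇q_i` is
injective on multipliers supported on the active set, with a lower bound that survives small
perturbations.

For stability, let `r`, `s`, `e` be the distances between two parameters, their minimisers and their
multipliers. Strong convexity of the two Lagrangians (`IsKKT.norm_sq_le`) bounds `μ s²` by a
multiple of `r e + r s`; the lower bound on the multiplier map bounds `e` by a multiple of `r + s`.
Eliminating `e` gives `s ≤ M r`. The constants are local in `(x, y)`, so continuity of the minimiser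
is needed beforehand (`IsKKT.continuousAt`).

By the Lipschitz bound, difference quotients of `z` along a ray stay in a compact set. Each cluster
point solves the KKT system linearised in the direction `d`, a complementarity problem with at most
one solution (`IsLinearizedKKT.unique`), so the quotients converge. Only then are the index sets
resolved: on `J⁺ ∪ J⁰₊` the constraint has zero derivative, elsewhere the multiplier has, and the
complementarity problem becomes the linear system with matrix `M_S`. Under strict complementarity
`z` solves a smooth square system with injective derivative near `x`, and the inverse function
theorem applies. -/

noncomputable section

open Filter Topology
open scoped RealInnerProductSpace NNReal

/-! ### Gradient inequalities, partial gradients, and directions with prescribed slopes. -/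

section FirstOrder

variable {X Y : Type*} [NormedAddCommGroup X] [InnerProductSpace ℝ X]
  [NormedAddCommGroup Y] [InnerProductSpace ℝ Y] [CompleteSpace Y]

theorem DifferentiableAt.hasDerivAt_comp_line {f : Y → ℝ} {y : Y} (hd : DifferentiableAt ℝ f y)
    (u : Y) : HasDerivAt (fun t : ℝ => f (y + t • u)) ⟪∇ f y, u⟫ 0 := by
  have h1 : HasDerivAt (fun t : ℝ => y + t • u) u 0 := by
    simpa using ((hasDerivAt_id (0 : ℝ)).smul_const u).const_add y
  have h2 : HasFDerivAt f (InnerProductSpace.toDual ℝ Y (∇ f y)) (y + (0 : ℝ) • u) := by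
    simpa using hd.hasFDerivAt
  exact h2.comp_hasDerivAt (0 : ℝ) h1

/-- First-order characterisation of strong convexity. -/
theorem StrongConvexOn.add_inner_gradient_le {f : Y → ℝ} {μ : ℝ}
    (hf : StrongConvexOn Set.univ μ f) {y : Y} (hd : DifferentiableAt ℝ f y) (y' : Y) :
    f y + ⟪∇ f y, y' - y⟫ + μ / 2 * ‖y' - y‖ ^ 2 ≤ f y' := by
  have hslope : Tendsto (fun t : ℝ => t⁻¹ • (f (y + t • (y' - y)) - f y)) (𝓝[>] 0)
      (𝓝 ⟪∇ f y, y' - y⟫) := by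
    have := (hd.hasDerivAt_comp_line (y' - y)).tendsto_slope_zero_right
    simpa using this
  -- The factor `1 - t` is what remains of the modulus term `t (1 - t) μ/2 ‖y' - y‖²` after division
  -- by `t`.
  have hrhs : Tendsto (fun t : ℝ => f y' - f y - (1 - t) * (μ / 2 * ‖y' - y‖ ^ 2)) (𝓝[>] 0)
      (𝓝 (f y' - f y - (1 - 0) * (μ / 2 * ‖y' - y‖ ^ 2))) := by
    apply Tendsto.mono_left _ nhdsWithin_le_nhds
    apply Continuous.tendsto
    fun_prop
  have hle := le_of_tendsto_of_tendsto hslope hrhs (by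
    filter_upwards [Ioo_mem_nhdsGT (zero_lt_one' ℝ)] with t ht
    have h := hf.2 (Set.mem_univ y') (Set.mem_univ y) ht.1.le (sub_nonneg.2 ht.2.le)
      (add_sub_cancel t 1)
    have e : t • y' + (1 - t) • y = y + t • (y' - y) := by module
    rw [e] at h
    simp only [smul_eq_mul] at h ⊢
    rw [inv_mul_le_iff₀ ht.1]
    linarith)
  linarith

theorem ConvexOn.add_inner_gradient_le {f : Y → ℝ}
    (hf : ConvexOn ℝ Set.univ f) {y : Y} (hd : DifferentiableAt ℝ f y) (y' : Y) :
    f y + ⟪∇ f y, y' - y⟫ ≤ f y' := by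
  have := (strongConvexOn_zero.2 hf).add_inner_gradient_le hd y'
  simpa using this

/-- Both `f` and `-f` are convex, so the gradient inequality holds in both directions. -/
theorem AffineMap.add_inner_gradient_eq {f : Y → ℝ} (A : Y →ᵃ[ℝ] ℝ) (hA : ∀ y, f y = A y) {y : Y}
    (hd : DifferentiableAt ℝ f y) (y' : Y) : f y' = f y + ⟪∇ f y, y' - y⟫ := by
  have hf : f = _root_.id ∘ A := funext hA
  have h1 : ConvexOn ℝ Set.univ f := by
    rw [hf]; exact (convexOn_id convex_univ).comp_affineMap A
  have h2 : ConvexOn ℝ Set.univ (-f) := by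
    rw [hf]; exact ((concaveOn_id convex_univ).comp_affineMap A).neg
  have h3 := h1.add_inner_gradient_le hd y'
  have h4 := h2.add_inner_gradient_le hd.neg y'
  have h5 : ∇ (-f) y = -∇ f y := by
    simp [gradient, fderiv_neg]
  rw [h5, inner_neg_left] at h4
  simp only [Pi.neg_apply] at h4
  linarith

/-- The partial gradient is the Riesz representative of the joint derivative restricted to the
second factor, so exactly one order of smoothness is lost. -/
theorem contDiff_partialGradient {f : X → Y → ℝ} (hf : ContDiff ℝ 2 fun w : X × Y => f w.1 w.2) :
    ContDiff ℝ 1 fun w : X × Y => ∇ (f w.1) w.2 := by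
  have h : (fun w : X × Y => ∇ (f w.1) w.2) = fun w : X × Y =>
      (InnerProductSpace.toDual ℝ Y).symm
        ((fderiv ℝ (fun w : X × Y => f w.1 w.2) w).comp (ContinuousLinearMap.inr ℝ X Y)) := by
    funext w
    have h1 : HasFDerivAt (fun w : X × Y => f w.1 w.2)
        (fderiv ℝ (fun w : X × Y => f w.1 w.2) (w.1, w.2)) (w.1, w.2) :=
      (hf.differentiable two_ne_zero _).hasFDerivAt
    have h2 := h1.comp w.2 (hasFDerivAt_prodMk_right w.1 w.2)
    rw [gradient]
    congr 1
    exact h2.fderiv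
  rw [h]
  have h3 : ContDiff ℝ 1 (fderiv ℝ (fun w : X × Y => f w.1 w.2)) :=
    hf.fderiv_right (by norm_num [one_add_one_eq_two])
  exact (InnerProductSpace.toDual ℝ Y).symm.contDiff.comp (h3.clm_comp contDiff_const)

theorem inner_partialGradient_snd {f : X → Y → ℝ} {x : X} {y : Y}
    (hf : DifferentiableAt ℝ (fun w : X × Y => f w.1 w.2) (x, y)) (u : Y) :
    ⟪∇ (f x) y, u⟫ = fderiv ℝ (fun w : X × Y => f w.1 w.2) (x, y) (0, u) := by
  have h2 := hf.hasFDerivAt.comp y (hasFDerivAt_prodMk_right x y)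
  rw [gradient, InnerProductSpace.toDual_symm_apply]
  exact congrArg (fun T => T u) h2.fderiv

theorem inner_partialGradient_fst [CompleteSpace X] {f : X → Y → ℝ} {x : X} {y : Y}
    (hf : DifferentiableAt ℝ (fun w : X × Y => f w.1 w.2) (x, y)) (d : X) :
    ⟪∇ (fun x' => f x' y) x, d⟫ = fderiv ℝ (fun w : X × Y => f w.1 w.2) (x, y) (d, 0) := by
  have h2 := hf.hasFDerivAt.comp (f := fun x' => (x', y)) x (hasFDerivAt_prodMk_left x y)
  rw [gradient, InnerProductSpace.toDual_symm_apply]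
  exact congrArg (fun T => T d) h2.fderiv

/-- The prescribed values define a functional on the span; extend it and represent it by Riesz.
Applied to the active gradients, this turns LICQ into a supply of directions. -/
theorem LinearIndependent.exists_inner_eq {ι : Type*} {v : ι → Y} [FiniteDimensional ℝ Y]
    (hv : LinearIndependent ℝ v) (c : ι → ℝ) : ∃ u : Y, ∀ i, ⟪v i, u⟫ = c i := by
  obtain ⟨φ, hφ⟩ := LinearMap.exists_extend ((Module.Basis.span hv).constr ℝ c)
  refine ⟨(InnerProductSpace.toDual ℝ Y).symm (LinearMap.toContinuousLinearMap φ), fun i => ?_⟩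
  rw [real_inner_comm, InnerProductSpace.toDual_symm_apply]
  have h := LinearMap.congr_fun hφ (Module.Basis.span hv i)
  simp only [LinearMap.comp_apply, Module.Basis.constr_basis, Submodule.subtype_apply] at h
  rw [Module.Basis.span_apply] at h
  simpa using h

end FirstOrder

/-! ### The multiplier map and strong convexity of the Lagrangian. -/

namespace ParamProgram

variable {dx dy m n : ℕ} {P : ParamProgram dx dy m n}
  {x : EuclideanSpace ℝ (Fin dx)} {y : EuclideanSpace ℝ (Fin dy)}
  {lam : EuclideanSpace ℝ (Fin m)} {nu : EuclideanSpace ℝ (Fin n)}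

variable (P) in
/-- The linear map `(lam, nu) ↦ ∑ lam_j ∇_y p_j(w) + ∑ nu_i ∇_y q_i(w)`. -/
def multiplierMap (w : EuclideanSpace ℝ (Fin dx) × EuclideanSpace ℝ (Fin dy)) :
    EuclideanSpace ℝ (Fin m) × EuclideanSpace ℝ (Fin n) →L[ℝ] EuclideanSpace ℝ (Fin dy) :=
  ∑ j, ((EuclideanSpace.proj j : EuclideanSpace ℝ (Fin m) →L[ℝ] ℝ).comp
      (ContinuousLinearMap.fst ℝ _ _)).smulRight (∇ (P.p j w.1) w.2) +
    ∑ i, ((EuclideanSpace.proj i : EuclideanSpace ℝ (Fin n) →L[ℝ] ℝ).comp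
      (ContinuousLinearMap.snd ℝ _ _)).smulRight (∇ (P.q i w.1) w.2)

theorem multiplierMap_apply (w : EuclideanSpace ℝ (Fin dx) × EuclideanSpace ℝ (Fin dy))
    (om : EuclideanSpace ℝ (Fin m) × EuclideanSpace ℝ (Fin n)) :
    P.multiplierMap w om =
      ∑ j, om.1 j • ∇ (P.p j w.1) w.2 + ∑ i, om.2 i • ∇ (P.q i w.1) w.2 := by
  simp [multiplierMap]

theorem IsC2.differentiableAt_g (h : P.IsC2) (w) :
    DifferentiableAt ℝ
      (fun w : EuclideanSpace ℝ (Fin dx) × EuclideanSpace ℝ (Fin dy) => P.g w.1 w.2) w :=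
  h.1.differentiable two_ne_zero w

theorem IsC2.differentiableAt_p (h : P.IsC2) (j) (w) :
    DifferentiableAt ℝ
      (fun w : EuclideanSpace ℝ (Fin dx) × EuclideanSpace ℝ (Fin dy) => P.p j w.1 w.2) w :=
  (h.2.1 j).differentiable two_ne_zero w

theorem IsC2.differentiableAt_q (h : P.IsC2) (i) (w) :
    DifferentiableAt ℝ
      (fun w : EuclideanSpace ℝ (Fin dx) × EuclideanSpace ℝ (Fin dy) => P.q i w.1 w.2) w :=
  (h.2.2 i).differentiable two_ne_zero w

theorem IsC2.differentiableAt_g_right (h : P.IsC2) : DifferentiableAt ℝ (P.g x) y :=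
  (h.differentiableAt_g (x, y)).comp (f := fun y' => (x, y')) y (by fun_prop)

theorem IsC2.differentiableAt_p_right (h : P.IsC2) (j) : DifferentiableAt ℝ (P.p j x) y :=
  (h.differentiableAt_p j (x, y)).comp (f := fun y' => (x, y')) y (by fun_prop)

theorem IsC2.differentiableAt_q_right (h : P.IsC2) (i) : DifferentiableAt ℝ (P.q i x) y :=
  (h.differentiableAt_q i (x, y)).comp (f := fun y' => (x, y')) y (by fun_prop)

theorem gradLagrangian_eq (h : P.IsC2) :
    P.gradLagrangian x y lam nu = ∇ (P.g x) y + P.multiplierMap (x, y) (lam, nu) := by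
  have h1 : HasFDerivAt (fun y' => P.lagrangian x y' lam nu)
      (fderiv ℝ (P.g x) y + ∑ j, lam j • fderiv ℝ (P.p j x) y
        + ∑ i, nu i • fderiv ℝ (P.q i x) y) y :=
    ((h.differentiableAt_g_right.hasFDerivAt).add
      (HasFDerivAt.fun_sum fun j _ => (h.differentiableAt_p_right j).hasFDerivAt.const_mul _)).add
      (HasFDerivAt.fun_sum fun i _ => (h.differentiableAt_q_right i).hasFDerivAt.const_mul _)
  rw [gradLagrangian, gradient, h1.fderiv, multiplierMap_apply]
  simp [gradient, map_sum, add_assoc]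

/-- First-order strong convexity of the Lagrangian in `y`. -/
theorem lagrangian_add_le {μ : ℝ} (h : P.IsC2) (hc : P.IsStronglyConvexProgram μ)
    (hlam : ∀ j, 0 ≤ lam j) (y' : EuclideanSpace ℝ (Fin dy)) :
    P.lagrangian x y lam nu + ⟪P.gradLagrangian x y lam nu, y' - y⟫ + μ / 2 * ‖y' - y‖ ^ 2 ≤
      P.lagrangian x y' lam nu := by
  have hg := (hc x).1.add_inner_gradient_le (h.differentiableAt_g_right (y := y)) y'
  have hp : ∑ j, lam j * (P.p j x y + ⟪∇ (P.p j x) y, y' - y⟫) ≤ ∑ j, lam j * P.p j x y' :=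
    Finset.sum_le_sum fun j _ => mul_le_mul_of_nonneg_left
      (((hc x).2.1 j).add_inner_gradient_le (h.differentiableAt_p_right j) y') (hlam j)
  have hq : ∑ i, nu i * (P.q i x y + ⟪∇ (P.q i x) y, y' - y⟫) = ∑ i, nu i * P.q i x y' := by
    refine Finset.sum_congr rfl fun i _ => ?_
    obtain ⟨A, hA⟩ := (hc x).2.2 i
    rw [A.add_inner_gradient_eq hA (h.differentiableAt_q_right i) y']
  rw [gradLagrangian_eq h, multiplierMap_apply]
  simp only [mul_add, Finset.sum_add_distrib] at hp hq
  simp only [lagrangian, inner_add_left, sum_inner, real_inner_smul_left]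
  linarith

theorem contDiff_multiplierMap (h : P.IsC2) : ContDiff ℝ 1 P.multiplierMap := by
  unfold multiplierMap
  refine ContDiff.add (ContDiff.sum fun j _ => ?_) (ContDiff.sum fun i _ => ?_)
  · exact contDiff_const.smulRight (contDiff_partialGradient (h.2.1 j))
  · exact contDiff_const.smulRight (contDiff_partialGradient (h.2.2 i))

/-- The gradient of the Lagrangian is jointly `C¹`. -/
theorem contDiff_gradLagrangian (h : P.IsC2) :
    ContDiff ℝ 1 fun w : EuclideanSpace ℝ (Fin dx) ×
        (EuclideanSpace ℝ (Fin dy) × EuclideanSpace ℝ (Fin m) × EuclideanSpace ℝ (Fin n)) =>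
      P.gradLagrangian w.1 w.2.1 w.2.2.1 w.2.2.2 := by
  simp only [gradLagrangian_eq h]
  have h1 : ContDiff ℝ 1 fun w : EuclideanSpace ℝ (Fin dx) ×
        (EuclideanSpace ℝ (Fin dy) × EuclideanSpace ℝ (Fin m) × EuclideanSpace ℝ (Fin n)) =>
      (w.1, w.2.1) := by fun_prop
  exact ((contDiff_partialGradient h.1).comp h1).add
    (((contDiff_multiplierMap h).comp h1).clm_apply (by fun_prop))

/-- LICQ as injectivity of the multiplier map on multipliers supported on the active set. -/
theorem LICQ.eq_zero (h : P.LICQ x y)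
    {om : EuclideanSpace ℝ (Fin m) × EuclideanSpace ℝ (Fin n)}
    (hs : ∀ j ∉ P.active x y, om.1 j = 0) (h0 : P.multiplierMap (x, y) om = 0) : om = 0 := by
  rw [multiplierMap_apply] at h0
  have h1 := Fintype.linearIndependent_iff.1 h
    (Sum.elim (fun j : P.active x y => om.1 j) (fun i => om.2 i)) (by
      rw [Fintype.sum_sum_type]
      simp only [Sum.elim_inl, Sum.elim_inr]
      rw [Finset.sum_coe_sort (P.active x y) (fun j => om.1 j • ∇ (P.p j x) y),
        Finset.sum_subset (Finset.subset_univ _)]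
      · exact h0
      · intro j _ hj
        simp [hs j hj])
  ext k
  · by_cases hk : k ∈ P.active x y
    · exact h1 (Sum.inl ⟨k, hk⟩)
    · exact hs k hk
  · exact h1 (Sum.inr k)

end ParamProgram

/-! ### Existence and uniqueness of the minimiser and of the multipliers. -/

theorem eventually_lt_of_inner_gradient_neg {Y : Type*} [NormedAddCommGroup Y]
    [InnerProductSpace ℝ Y] [CompleteSpace Y] {f : Y → ℝ} {y u : Y} (hd : DifferentiableAt ℝ f y)
    (hu : ⟪∇ f y, u⟫ < 0) : ∀ᶠ t : ℝ in 𝓝[>] 0, f (y + t • u) < f y := by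
  have h4 : Tendsto (fun t : ℝ => t⁻¹ • (f (y + t • u) - f y)) (𝓝[>] 0) (𝓝 ⟪∇ f y, u⟫) := by
    simpa using (hd.hasDerivAt_comp_line u).tendsto_slope_zero_right
  filter_upwards [h4.eventually_lt_const hu, self_mem_nhdsWithin] with t ht ht0
  have ht0 : 0 < t := ht0
  rw [smul_eq_mul] at ht
  have := (pos_iff_neg_of_mul_neg ht).1 (inv_pos.2 ht0)
  linarith

namespace ParamProgram

variable {dx dy m n : ℕ} {P : ParamProgram dx dy m n} {μ : ℝ}
  {x : EuclideanSpace ℝ (Fin dx)} {y : EuclideanSpace ℝ (Fin dy)}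
  {lam : EuclideanSpace ℝ (Fin m)} {nu : EuclideanSpace ℝ (Fin n)}

theorem mem_active {j : Fin m} : j ∈ P.active x y ↔ P.p j x y = 0 := by simp [active]

/-- Weak duality. Together with equality at KKT points, which is complementarity, it converts strong
convexity of the Lagrangian into estimates for the constrained problem. -/
theorem lagrangian_le_of_mem_feasible (hlam : ∀ j, 0 ≤ lam j) (hy : y ∈ P.feasible x) :
    P.lagrangian x y lam nu ≤ P.g x y := by
  have h1 : ∑ j, lam j * P.p j x y ≤ 0 :=
    Finset.sum_nonpos fun j _ => mul_nonpos_of_nonneg_of_nonpos (hlam j) (hy.1 j)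
  have h2 : ∑ i, nu i * P.q i x y = 0 := Finset.sum_eq_zero fun i _ => by simp [hy.2 i]
  simp only [lagrangian]
  linarith

theorem IsKKT.lagrangian_eq (hk : P.IsKKT x y lam nu) : P.lagrangian x y lam nu = P.g x y := by
  obtain ⟨-, -, h2, -, h4⟩ := hk
  simp [lagrangian, h2, h4]

theorem IsKKT.mem_feasible (hk : P.IsKKT x y lam nu) : y ∈ P.feasible x := ⟨hk.2.1, hk.2.2.1⟩

theorem IsKKT.eq_zero_of_notMem_active (hk : P.IsKKT x y lam nu) {j : Fin m}
    (hj : j ∉ P.active x y) : lam j = 0 :=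
  (mul_eq_zero.1 (hk.2.2.2.2 j)).resolve_right fun h => hj (mem_active.2 h)

/-- Quadratic growth at a KKT point. -/
theorem IsKKT.add_le (h : P.IsC2) (hc : P.IsStronglyConvexProgram μ) (hk : P.IsKKT x y lam nu)
    {y' : EuclideanSpace ℝ (Fin dy)} (hy' : y' ∈ P.feasible x) :
    P.g x y + μ / 2 * ‖y' - y‖ ^ 2 ≤ P.g x y' := by
  have h1 := lagrangian_add_le (x := x) (y := y) (nu := nu) h hc hk.2.2.2.1 y'
  rw [hk.1, inner_zero_left, hk.lagrangian_eq] at h1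
  have h2 := lagrangian_le_of_mem_feasible (P := P) (nu := nu) hk.2.2.2.1 hy'
  linarith

theorem IsKKT.eq_of_isSolution (h : P.IsC2) (hμ : 0 < μ) (hc : P.IsStronglyConvexProgram μ)
    (hk : P.IsKKT x y lam nu)
    {y' : EuclideanSpace ℝ (Fin dy)} (hy' : P.IsSolution x y') : y' = y := by
  have h1 := hk.add_le h hc hy'.1
  have h2 := hy'.2 y hk.mem_feasible
  have h3 : ‖y' - y‖ ^ 2 ≤ 0 := by nlinarith
  have h4 : ‖y' - y‖ = 0 := by nlinarith [norm_nonneg (y' - y)]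
  exact sub_eq_zero.1 (norm_eq_zero.1 h4)

/-- By complementarity the difference of two multipliers is supported on the active set, and by
stationarity the multiplier map kills it. -/
theorem IsKKT.multipliers_unique (h : P.IsC2) (hl : P.LICQ x y) (hk : P.IsKKT x y lam nu)
    {lam' : EuclideanSpace ℝ (Fin m)} {nu' : EuclideanSpace ℝ (Fin n)}
    (hk' : P.IsKKT x y lam' nu') : lam' = lam ∧ nu' = nu := by
  have h0 : (lam', nu') - (lam, nu) = 0 := by
    refine hl.eq_zero (fun j hj => ?_) ?_
    · simp [hk.eq_zero_of_notMem_active hj, hk'.eq_zero_of_notMem_active hj]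
    · have h1 := hk.1
      have h2 := hk'.1
      rw [gradLagrangian_eq h] at h1 h2
      rw [map_sub, sub_eq_zero]
      exact add_left_cancel (h2.trans h1.symm)
  have := sub_eq_zero.1 h0
  exact Prod.mk.inj this

theorem IsC2.continuous_g (h : P.IsC2) : Continuous (P.g x) :=
  h.1.continuous.comp (Continuous.prodMk_right x)

theorem IsC2.continuous_p (h : P.IsC2) (j) : Continuous (P.p j x) :=
  (h.2.1 j).continuous.comp (Continuous.prodMk_right x)

theorem IsC2.continuous_q (h : P.IsC2) (i) : Continuous (P.q i x) :=
  (h.2.2 i).continuous.comp (Continuous.prodMk_right x)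

theorem exists_isSolution (h : P.IsC2) (hμ : 0 < μ) (hc : P.IsStronglyConvexProgram μ)
    (hf : (P.feasible x).Nonempty) : ∃ y, P.IsSolution x y := by
  obtain ⟨y₀, hy₀⟩ := hf
  have hclosed : IsClosed (P.feasible x) := by
    refine IsClosed.inter (s₁ := {y | ∀ j, P.p j x y ≤ 0}) (s₂ := {y | ∀ i, P.q i x y = 0}) ?_ ?_
    · simp only [Set.ofPred_forall]
      exact isClosed_iInter fun j => isClosed_le (h.continuous_p j) continuous_const
    · simp only [Set.ofPred_forall]
      exact isClosed_iInter fun i => isClosed_eq (h.continuous_q i) continuous_const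
  obtain ⟨y, hy, hmin⟩ := (h.continuous_g (x := x)).continuousOn.exists_isMinOn' hclosed hy₀ (by
    refine Filter.Eventually.filter_mono inf_le_left ?_
    have hN : Tendsto (fun y : EuclideanSpace ℝ (Fin dy) => ‖y - y₀‖) (cocompact _) atTop := by
      have := (tendsto_norm_cocompact_atTop (E := EuclideanSpace ℝ (Fin dy))).comp
        (Homeomorph.subRight y₀).isClosedEmbedding.tendsto_cocompact
      exact this
    -- Beyond this radius the quadratic term of the strong convexity inequality at `y₀` dominates
    -- the linear one, so the objective is at least its value at `y₀`.
    filter_upwards [hN.eventually_ge_atTop (2 / μ * ‖∇ (P.g x) y₀‖)] with y hy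
    have h1 := (hc x).1.add_inner_gradient_le (h.differentiableAt_g_right (y := y₀)) y
    have h2 := neg_le_of_abs_le (abs_real_inner_le_norm (∇ (P.g x) y₀) (y - y₀))
    have h3 : ‖∇ (P.g x) y₀‖ ≤ μ / 2 * ‖y - y₀‖ := by
      have := mul_le_mul_of_nonneg_left hy (by positivity : 0 ≤ μ / 2)
      have e : μ / 2 * (2 / μ * ‖∇ (P.g x) y₀‖) = ‖∇ (P.g x) y₀‖ := by field_simp
      linarith
    nlinarith [norm_nonneg (y - y₀)])
  exact ⟨y, hy, fun y' hy' => hmin hy'⟩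

/-- At a solution there is no direction of strict decrease of the objective and of the active
inequality constraints that preserves the equality constraints. -/
theorem IsSolution.not_descent (h : P.IsC2) (hc : P.IsStronglyConvexProgram μ)
    (hs : P.IsSolution x y) (u : EuclideanSpace ℝ (Fin dy)) (hg : ⟪∇ (P.g x) y, u⟫ < 0)
    (hp : ∀ j ∈ P.active x y, ⟪∇ (P.p j x) y, u⟫ < 0) (hq : ∀ i, ⟪∇ (P.q i x) y, u⟫ = 0) :
    False := by
  have h1 := eventually_lt_of_inner_gradient_neg h.differentiableAt_g_right hg
  have h2 : ∀ᶠ t : ℝ in 𝓝[>] 0, ∀ j, P.p j x (y + t • u) ≤ 0 := by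
    refine eventually_all.2 fun j => ?_
    by_cases hj : j ∈ P.active x y
    · filter_upwards [eventually_lt_of_inner_gradient_neg (h.differentiableAt_p_right j)
        (hp j hj)] with t ht
      exact (ht.trans_eq (mem_active.1 hj)).le
    · have hlt : P.p j x y < 0 := lt_of_le_of_ne (hs.1.1 j) fun h => hj (mem_active.2 h)
      have hcont : Tendsto (fun t : ℝ => P.p j x (y + t • u)) (𝓝 0) (𝓝 (P.p j x (y + (0 : ℝ) • u))) :=
        ((h.continuous_p j).comp (by fun_prop)).tendsto 0
      rw [zero_smul, add_zero] at hcont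
      exact ((hcont.eventually_lt_const hlt).filter_mono nhdsWithin_le_nhds).mono
        fun _ => le_of_lt
  obtain ⟨t, ht1, ht2⟩ := (h1.and h2).exists
  refine absurd (hs.2 (y + t • u) ⟨ht2, fun i => ?_⟩) (not_le.2 ht1)
  obtain ⟨A, hA⟩ := (hc x).2.2 i
  rw [A.add_inner_gradient_eq hA (h.differentiableAt_q_right (y := y) i), hs.1.2 i,
    add_sub_cancel_left, real_inner_smul_right, hq i]
  simp

/-- The KKT theorem under LICQ. -/
theorem IsSolution.exists_isKKT (h : P.IsC2) (hc : P.IsStronglyConvexProgram μ)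
    (hs : P.IsSolution x y) (hl : P.LICQ x y) : ∃ lam nu, P.IsKKT x y lam nu := by
  classical
  set fam : P.active x y ⊕ Fin n → EuclideanSpace ℝ (Fin dy) :=
    Sum.elim (fun j : P.active x y => ∇ (P.p j x) y) (fun i : Fin n => ∇ (P.q i x) y) with hfam
  have hl' : LinearIndependent ℝ fam := hl
  -- Otherwise `∇g` can be adjoined to the independent family, and some direction has slope `-1` on
  -- the objective and the active constraints and `0` on the equalities.
  have hmem : ∇ (P.g x) y ∈ Submodule.span ℝ (Set.range fam) := by
    by_contra hn
    have hli : LinearIndependent ℝ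
        (fun o : Option (P.active x y ⊕ Fin n) => o.elim (∇ (P.g x) y) fam) :=
      linearIndependent_option.2 ⟨hl', hn⟩
    obtain ⟨u, hu⟩ := hli.exists_inner_eq
      (fun o => o.elim (-1) (Sum.elim (fun _ => -1) (fun _ => 0)))
    refine hs.not_descent h hc u ?_ (fun j hj => ?_) (fun i => ?_)
    · have := hu none
      simp only [Option.elim_none] at this
      rw [this]; norm_num
    · have := hu (some (Sum.inl ⟨j, hj⟩))
      simp only [Option.elim_some, hfam, Sum.elim_inl] at this
      rw [this]; norm_num
    · have := hu (some (Sum.inr i))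
      simpa only [Option.elim_some, hfam, Sum.elim_inr] using this
  obtain ⟨c, hcsum⟩ := (Submodule.mem_span_range_iff_exists_fun ℝ).1 hmem
  have hsign : ∀ k, c (Sum.inl k) ≤ 0 := by
    intro k
    by_contra! hk
    -- A direction with slope `-1` on every active `p_j`, except `-(1 + R)` on the `k`-th, gives the
    -- objective slope `-∑ c_j - c_k R`; this `R` makes it `-∑ c_j - |∑ c_j| - 1 < 0`.
    set R := (|∑ j, c (Sum.inl j)| + 1) / c (Sum.inl k) with hR
    have hR0 : 0 < R := by positivity
    obtain ⟨u, hu⟩ := hl'.exists_inner_eq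
      (Sum.elim (fun j => -(1 + if j = k then R else 0)) (fun _ => 0))
    refine hs.not_descent h hc u ?_ (fun j hj => ?_) (fun i => ?_)
    · rw [← hcsum, sum_inner]
      simp only [real_inner_smul_left, hu]
      rw [Fintype.sum_sum_type]
      simp only [Sum.elim_inl, Sum.elim_inr, mul_neg, mul_add, mul_one, mul_ite, mul_zero,
        Finset.sum_neg_distrib, Finset.sum_add_distrib, Finset.sum_ite_eq', Finset.mem_univ,
        if_true, Finset.sum_const_zero, add_zero]
      have : c (Sum.inl k) * R = |∑ j, c (Sum.inl j)| + 1 := by rw [hR]; field_simp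
      rw [this]
      linarith [neg_le_abs (∑ j, c (Sum.inl j))]
    · have := hu (Sum.inl ⟨j, hj⟩)
      simp only [hfam, Sum.elim_inl] at this
      rw [this]
      split_ifs <;> linarith
    · have := hu (Sum.inr i)
      simpa only [hfam, Sum.elim_inr] using this
  refine ⟨WithLp.toLp 2 fun j => if hj : j ∈ P.active x y then -c (Sum.inl ⟨j, hj⟩) else 0,
    WithLp.toLp 2 fun i => -c (Sum.inr i), ?_, hs.1.1, hs.1.2, fun j => ?_, fun j => ?_⟩
  · rw [gradLagrangian_eq h, multiplierMap_apply, ← hcsum, Fintype.sum_sum_type]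
    have e1 : ∑ j, (if hj : j ∈ P.active x y then -c (Sum.inl ⟨j, hj⟩) else 0) • ∇ (P.p j x) y
        = ∑ j : P.active x y, -c (Sum.inl j) • ∇ (P.p j x) y := by
      rw [← Finset.sum_subset (Finset.subset_univ (P.active x y)) (fun j _ hj => by simp [hj]),
        ← Finset.sum_coe_sort]
      exact Finset.sum_congr rfl fun j _ => by simp
    simp only [e1, hfam, Sum.elim_inl, Sum.elim_inr, neg_smul, Finset.sum_neg_distrib]
    abel
  · by_cases hj : j ∈ P.active x y
    · simpa [hj] using hsign ⟨j, hj⟩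
    · simp [hj]
  · by_cases hj : j ∈ P.active x y
    · simp [mem_active.1 hj]
    · simp [hj]

end ParamProgram

/-! ### Stability: continuity and local Lipschitz dependence on the parameter. -/

namespace ParamProgram

variable {dx dy m n : ℕ} {P : ParamProgram dx dy m n} {μ : ℝ}
  {x x₀ : EuclideanSpace ℝ (Fin dx)} {y y₀ : EuclideanSpace ℝ (Fin dy)}
  {lam lam₀ : EuclideanSpace ℝ (Fin m)} {nu nu₀ : EuclideanSpace ℝ (Fin n)}

variable (P) in
/-- The linear functional `(lam, nu) ↦ ∑ lam_j p_j(w) + ∑ nu_i q_i(w)`. -/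
def constraintMap (w : EuclideanSpace ℝ (Fin dx) × EuclideanSpace ℝ (Fin dy)) :
    EuclideanSpace ℝ (Fin m) × EuclideanSpace ℝ (Fin n) →L[ℝ] ℝ :=
  ∑ j, ((EuclideanSpace.proj j : EuclideanSpace ℝ (Fin m) →L[ℝ] ℝ).comp
      (ContinuousLinearMap.fst ℝ _ _)).smulRight (P.p j w.1 w.2) +
    ∑ i, ((EuclideanSpace.proj i : EuclideanSpace ℝ (Fin n) →L[ℝ] ℝ).comp
      (ContinuousLinearMap.snd ℝ _ _)).smulRight (P.q i w.1 w.2)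

theorem constraintMap_apply (w : EuclideanSpace ℝ (Fin dx) × EuclideanSpace ℝ (Fin dy))
    (om : EuclideanSpace ℝ (Fin m) × EuclideanSpace ℝ (Fin n)) :
    P.constraintMap w om =
      ∑ j, om.1 j * P.p j w.1 w.2 + ∑ i, om.2 i * P.q i w.1 w.2 := by
  simp [constraintMap]

theorem lagrangian_eq_add_constraintMap :
    P.lagrangian x y lam nu = P.g x y + P.constraintMap (x, y) (lam, nu) := by
  rw [constraintMap_apply, lagrangian, add_assoc]

theorem contDiff_constraintMap (h : P.IsC2) : ContDiff ℝ 1 P.constraintMap := by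
  unfold constraintMap
  refine ContDiff.add (ContDiff.sum fun j _ => ?_) (ContDiff.sum fun i _ => ?_)
  · exact contDiff_const.smulRight ((h.2.1 j).of_le one_le_two)
  · exact contDiff_const.smulRight ((h.2.2 i).of_le one_le_two)

/-- Under LICQ the multiplier map is uniformly bounded below nearby, on multipliers supported on
the active set. -/
theorem LICQ.exists_le_norm (h : P.IsC2) (hl : P.LICQ x₀ y₀) :
    ∃ c : ℝ, 0 < c ∧ ∀ᶠ w in 𝓝 (x₀, y₀),
      ∀ om : EuclideanSpace ℝ (Fin m) × EuclideanSpace ℝ (Fin n),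
        (∀ j ∉ P.active x₀ y₀, om.1 j = 0) → c * ‖om‖ ≤ ‖P.multiplierMap w om‖ := by
  let V : Submodule ℝ (EuclideanSpace ℝ (Fin m) × EuclideanSpace ℝ (Fin n)) :=
    { carrier := {om | ∀ j ∉ P.active x₀ y₀, om.1 j = 0}
      add_mem' := fun {a b} ha hb j hj => by simp [ha j hj, hb j hj]
      zero_mem' := fun j _ => by simp
      smul_mem' := fun r a ha j hj => by simp [ha j hj] }
  obtain ⟨K, hK, hanti⟩ := LinearMap.exists_antilipschitzWith
    ((P.multiplierMap (x₀, y₀)).toLinearMap.comp V.subtype) (by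
      rw [LinearMap.ker_eq_bot']
      intro om hom
      exact Subtype.ext (hl.eq_zero om.2 hom))
  have hK' : (0 : ℝ) < K := hK
  -- At the base point the lower bound is `K⁻¹`; a perturbation of operator norm at most half of it
  -- leaves the other half.
  refine ⟨(2 * K)⁻¹, by positivity, ?_⟩
  have hcont := (contDiff_multiplierMap h).continuous.tendsto (x₀, y₀)
  filter_upwards [hcont (Metric.ball_mem_nhds _ (by positivity : 0 < (2 * (K : ℝ))⁻¹))] with w hw om hom
  have h1 : ‖om‖ ≤ K * ‖P.multiplierMap (x₀, y₀) om‖ := by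
    have := hanti.le_mul_dist (⟨om, hom⟩ : V) 0
    simpa [dist_eq_norm] using this
  have h2 : ‖P.multiplierMap w - P.multiplierMap (x₀, y₀)‖ ≤ (2 * (K : ℝ))⁻¹ := by
    have : P.multiplierMap w ∈ Metric.ball (P.multiplierMap (x₀, y₀)) (2 * (K : ℝ))⁻¹ := hw
    rw [mem_ball_iff_norm] at this
    exact this.le
  have h3 : ‖(P.multiplierMap w - P.multiplierMap (x₀, y₀)) om‖ ≤ (2 * (K : ℝ))⁻¹ * ‖om‖ :=
    ContinuousLinearMap.le_of_opNorm_le _ h2 om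
  have h4 : ‖P.multiplierMap (x₀, y₀) om‖ ≤ ‖P.multiplierMap w om‖ +
      ‖(P.multiplierMap w - P.multiplierMap (x₀, y₀)) om‖ := by
    rw [sub_apply]
    exact norm_le_insert _ _
  have h5 : (K : ℝ)⁻¹ * ‖om‖ ≤ ‖P.multiplierMap (x₀, y₀) om‖ := by
    rwa [inv_mul_le_iff₀ hK']
  have h6 : (K : ℝ)⁻¹ = (2 * (K : ℝ))⁻¹ + (2 * (K : ℝ))⁻¹ := by field_simp; norm_num
  rw [h6, add_mul] at h5
  linarith

/-- Under LICQ, feasible points persist under small perturbations of the parameter. -/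
theorem LICQ.eventually_exists_feasible (h : P.IsC2) (hl : P.LICQ x₀ y₀)
    (hy₀ : y₀ ∈ P.feasible x₀)
    {W : Set (EuclideanSpace ℝ (Fin dx) × EuclideanSpace ℝ (Fin dy))} (hW : W ∈ 𝓝 (x₀, y₀)) :
    ∀ᶠ x in 𝓝 x₀, ∃ y, (x, y) ∈ W ∧ y ∈ P.feasible x := by
  let Dp := fun j => fderiv ℝ
    (fun w : EuclideanSpace ℝ (Fin dx) × EuclideanSpace ℝ (Fin dy) => P.p j w.1 w.2) (x₀, y₀)
  let Dq := fun i => fderiv ℝ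
    (fun w : EuclideanSpace ℝ (Fin dx) × EuclideanSpace ℝ (Fin dy) => P.q i w.1 w.2) (x₀, y₀)
  -- With `x` kept as a component and the active inequalities treated as equalities, LICQ makes the
  -- derivative onto. So `F` maps neighbourhoods of `(x₀, y₀)` to neighbourhoods of `(x₀, 0, 0)`,
  -- which contain `(x, 0, 0)` for all `x` near `x₀`.
  let F : EuclideanSpace ℝ (Fin dx) × EuclideanSpace ℝ (Fin dy) →
      EuclideanSpace ℝ (Fin dx) × (P.active x₀ y₀ → ℝ) × (Fin n → ℝ) :=
    fun w => (w.1, (fun j => P.p j w.1 w.2), fun i => P.q i w.1 w.2)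
  let F' : EuclideanSpace ℝ (Fin dx) × EuclideanSpace ℝ (Fin dy) →L[ℝ]
      EuclideanSpace ℝ (Fin dx) × (P.active x₀ y₀ → ℝ) × (Fin n → ℝ) :=
    (ContinuousLinearMap.fst ℝ _ _).prod
      ((ContinuousLinearMap.pi fun j : P.active x₀ y₀ => Dp j).prod (ContinuousLinearMap.pi Dq))
  have hF : HasStrictFDerivAt F F' (x₀, y₀) := by
    refine hasStrictFDerivAt_fst.prodMk (HasStrictFDerivAt.prodMk ?_ ?_)
    · exact hasStrictFDerivAt_pi.2 fun j =>
        (h.2.1 j).contDiffAt.hasStrictFDerivAt two_ne_zero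
    · exact hasStrictFDerivAt_pi.2 fun i =>
        (h.2.2 i).contDiffAt.hasStrictFDerivAt two_ne_zero
  have hsurj : F'.range = ⊤ := by
    rw [LinearMap.range_eq_top]
    rintro ⟨d, a, b⟩
    obtain ⟨u, hu⟩ := LinearIndependent.exists_inner_eq hl
      (Sum.elim (fun j => a j - Dp j (d, 0)) (fun i => b i - Dq i (d, 0)))
    refine ⟨(d, u), Prod.ext rfl (Prod.ext (funext fun j => ?_) (funext fun i => ?_))⟩
    · have h1 := hu (Sum.inl j)
      simp only [Sum.elim_inl] at h1
      rw [inner_partialGradient_snd (h.differentiableAt_p j _)] at h1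
      change Dp j (d, u) = a j
      have h2 : ((d, u) : EuclideanSpace ℝ (Fin dx) × EuclideanSpace ℝ (Fin dy))
        = (d, 0) + (0, u) := by simp
      rw [h2, map_add]
      linarith
    · have h1 := hu (Sum.inr i)
      simp only [Sum.elim_inr] at h1
      rw [inner_partialGradient_snd (h.differentiableAt_q i _)] at h1
      change Dq i (d, u) = b i
      have h2 : ((d, u) : EuclideanSpace ℝ (Fin dx) × EuclideanSpace ℝ (Fin dy))
        = (d, 0) + (0, u) := by simp
      rw [h2, map_add]
      linarith
  have hmap := hF.map_nhds_eq_of_surj hsurj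
  have hF0 : F (x₀, y₀) = (x₀, 0, 0) :=
    Prod.ext rfl (Prod.ext (funext fun j => mem_active.1 j.2) (funext fun i => hy₀.2 i))
  have hin : ∀ᶠ w in 𝓝 (x₀, y₀), ∀ j ∉ P.active x₀ y₀, P.p j w.1 w.2 < 0 := by
    refine eventually_all.2 fun j => ?_
    by_cases hj : j ∈ P.active x₀ y₀
    · simp [hj]
    · have hlt : P.p j x₀ y₀ < 0 := lt_of_le_of_ne (hy₀.1 j) fun h => hj (mem_active.2 h)
      filter_upwards [((h.2.1 j).continuous.tendsto (x₀, y₀)).eventually_lt_const hlt] with w hw _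
      exact hw
  have himg : F '' (W ∩ {w | ∀ j ∉ P.active x₀ y₀, P.p j w.1 w.2 < 0}) ∈ 𝓝 (x₀, 0, 0) := by
    rw [← hF0, ← hmap]
    exact image_mem_map (inter_mem hW hin)
  have hemb : Tendsto (fun x : EuclideanSpace ℝ (Fin dx) =>
      (x, (0 : P.active x₀ y₀ → ℝ), (0 : Fin n → ℝ))) (𝓝 x₀) (𝓝 (x₀, 0, 0)) :=
    Continuous.tendsto (by fun_prop) x₀
  filter_upwards [hemb himg] with x hx
  obtain ⟨⟨x', y⟩, ⟨hwW, hw⟩, hFw⟩ := hx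
  obtain ⟨rfl, hp, hq⟩ : x' = x ∧ (fun j : P.active x₀ y₀ => P.p j x' y) = 0 ∧
      (fun i => P.q i x' y) = 0 := by
    simpa [F] using hFw
  refine ⟨y, hwW, fun j => ?_, fun i => congrFun hq i⟩
  by_cases hj : j ∈ P.active x₀ y₀
  · exact (congrFun hp ⟨j, hj⟩).le
  · exact (hw j hj).le

/-- The solution map is continuous. -/
theorem IsKKT.continuousAt (h : P.IsC2) (hμ : 0 < μ) (hc : P.IsStronglyConvexProgram μ)
    {ystar : EuclideanSpace ℝ (Fin dx) → EuclideanSpace ℝ (Fin dy)}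
    (hs : ∀ x, P.IsSolution x (ystar x)) (hl : P.LICQ x₀ (ystar x₀))
    (hk : P.IsKKT x₀ (ystar x₀) lam₀ nu₀) : ContinuousAt ystar x₀ := by
  rw [Metric.continuousAt_iff']
  intro ε hε
  set y₀ := ystar x₀ with hy₀
  have hgrad : Tendsto (fun x => P.gradLagrangian x y₀ lam₀ nu₀) (𝓝 x₀) (𝓝 0) := by
    rw [← hk.1]
    exact ((contDiff_gradLagrangian h).continuous.comp
      (f := fun x => (x, (y₀, lam₀, nu₀))) (by fun_prop)).tendsto x₀
  have hlag : Tendsto (fun x => P.lagrangian x y₀ lam₀ nu₀) (𝓝 x₀) (𝓝 (P.g x₀ y₀)) := by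
    rw [← hk.lagrangian_eq]
    simp only [lagrangian_eq_add_constraintMap]
    exact ((h.1.continuous.comp (f := fun x => (x, y₀)) (by fun_prop)).add
      (((contDiff_constraintMap h).continuous.comp (f := fun x => (x, y₀)) (by fun_prop)).clm_apply
        continuous_const)).tendsto x₀
  -- If `s = ‖ystar x - y₀‖ ≥ ε`, the errors sum to `2 · με²/8 + (με/4) s ≤ μ s²/2`, contradicting
  -- the strong convexity gain `μ s²/2`. The two value errors come from the feasible competitor near
  -- `y₀` and from the Lagrangian at `y₀`, the last one from its gradient.
  have hη : 0 < μ * ε ^ 2 / 8 := by positivity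
  have hW : {w : EuclideanSpace ℝ (Fin dx) × EuclideanSpace ℝ (Fin dy) |
      P.g w.1 w.2 < P.g x₀ y₀ + μ * ε ^ 2 / 8} ∈ 𝓝 (x₀, y₀) :=
    (h.1.continuous.tendsto (x₀, y₀)).eventually_lt_const (by linarith)
  filter_upwards [hl.eventually_exists_feasible h hk.mem_feasible hW,
    hlag.eventually_const_lt (show P.g x₀ y₀ - μ * ε ^ 2 / 8 < P.g x₀ y₀ by linarith),
    hgrad (Metric.ball_mem_nhds 0 (by positivity : 0 < μ * ε / 4))] with x hx1 hx2 hx3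
  obtain ⟨y', hy'1, hy'2⟩ := hx1
  have hy'1 : P.g x y' < P.g x₀ y₀ + μ * ε ^ 2 / 8 := hy'1
  have hx3 : ‖P.gradLagrangian x y₀ lam₀ nu₀‖ < μ * ε / 4 := by simpa using hx3
  have h1 := lagrangian_add_le (x := x) (y := y₀) (nu := nu₀) h hc hk.2.2.2.1 (ystar x)
  have h2 := lagrangian_le_of_mem_feasible (P := P) (nu := nu₀) hk.2.2.2.1 (hs x).1
  have h3 := (hs x).2 y' hy'2
  have h4 := neg_le_of_abs_le
    (abs_real_inner_le_norm (P.gradLagrangian x y₀ lam₀ nu₀) (ystar x - y₀))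
  rw [dist_eq_norm]
  by_contra! hge
  have h5 := mul_le_mul_of_nonneg_right hx3.le (norm_nonneg (ystar x - y₀))
  have h6 : μ * ε * ‖ystar x - y₀‖ ≤ μ * ‖ystar x - y₀‖ ^ 2 := by
    have := mul_le_mul_of_nonneg_left hge (mul_nonneg hμ.le (norm_nonneg (ystar x - y₀)))
    nlinarith
  have h7 : μ * ε ^ 2 ≤ μ * ‖ystar x - y₀‖ ^ 2 := by gcongr
  nlinarith

theorem constraintMap_nonpos (hlam : ∀ j, 0 ≤ lam j) (hy : y ∈ P.feasible x) :
    P.constraintMap (x, y) (lam, nu) ≤ 0 := by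
  have := lagrangian_le_of_mem_feasible (P := P) (nu := nu) hlam hy
  rw [lagrangian_eq_add_constraintMap] at this
  linarith

theorem IsKKT.constraintMap_eq_zero (hk : P.IsKKT x y lam nu) :
    P.constraintMap (x, y) (lam, nu) = 0 := by
  have := hk.lagrangian_eq
  rw [lagrangian_eq_add_constraintMap] at this
  linarith

/-- Monotonicity estimate comparing KKT points of two different parameters. -/
theorem IsKKT.norm_sq_le (h : P.IsC2) (hc : P.IsStronglyConvexProgram μ)
    {x₁ x₂ : EuclideanSpace ℝ (Fin dx)} {y₁ y₂ : EuclideanSpace ℝ (Fin dy)}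
    {om₁ om₂ : EuclideanSpace ℝ (Fin m) × EuclideanSpace ℝ (Fin n)}
    (h₁ : P.IsKKT x₁ y₁ om₁.1 om₁.2) (h₂ : P.IsKKT x₂ y₂ om₂.1 om₂.2) :
    μ * ‖y₁ - y₂‖ ^ 2 ≤ ‖P.constraintMap (x₁, y₂) - P.constraintMap (x₂, y₂)‖ * ‖om₁ - om₂‖ +
      ‖P.gradLagrangian x₁ y₂ om₂.1 om₂.2‖ * ‖y₁ - y₂‖ := by
  -- Both Lagrangians are taken at the same parameter `x₁`, so the objective cancels on adding. The
  -- remaining constraint terms are zero by complementarity or nonpositive by feasibility, up to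
  -- moving the constraints at `y₂` from `x₁` to `x₂`.
  have a1 := lagrangian_add_le (x := x₁) (y := y₁) (nu := om₁.2) h hc h₁.2.2.2.1 y₂
  have a2 := lagrangian_add_le (x := x₁) (y := y₂) (nu := om₂.2) h hc h₂.2.2.2.1 y₁
  rw [h₁.1, inner_zero_left, norm_sub_rev] at a1
  simp only [lagrangian_eq_add_constraintMap, Prod.mk.eta] at a1 a2
  have b1 := h₁.constraintMap_eq_zero
  have b2 := h₂.constraintMap_eq_zero
  have b3 := constraintMap_nonpos (P := P) (nu := om₁.2) h₁.2.2.2.1 h₂.mem_feasible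
  have b4 := constraintMap_nonpos (P := P) (nu := om₂.2) h₂.2.2.2.1 h₁.mem_feasible
  simp only [Prod.mk.eta] at b1 b2 b3 b4
  have c1 := neg_le_of_abs_le
    (abs_real_inner_le_norm (P.gradLagrangian x₁ y₂ om₂.1 om₂.2) (y₁ - y₂))
  have c2 := (le_abs_self _).trans
    ((P.constraintMap (x₁, y₂) - P.constraintMap (x₂, y₂)).le_opNorm (om₁ - om₂))
  simp only [sub_apply, map_sub] at c2
  linarith

/-- If the bound fails then `r ≤ s`, thanks to the summand `1`; hence `r + 2 s ≤ 3 s`, and one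
factor `s` cancels. -/
theorem le_mul_of_sq_le {μ C r s : ℝ} (hμ : 0 < μ) (hC : 0 ≤ C) (hr : 0 ≤ r)
    (h : μ * s ^ 2 ≤ C * r * (r + 2 * s)) : s ≤ (1 + 3 * C / μ) * r := by
  by_contra! hlt
  have h0 : 0 ≤ 3 * C / μ := by positivity
  have h1 : r ≤ s := by nlinarith [mul_nonneg h0 hr]
  have hpos : 0 < s := lt_of_le_of_lt (by positivity) hlt
  have h2 : μ * s ^ 2 ≤ 3 * C * r * s := by nlinarith [mul_le_mul_of_nonneg_left h1 (mul_nonneg hC hr)]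
  have h3 : μ * s ≤ 3 * C * r := by
    by_contra! hcon
    nlinarith
  have h4 : s ≤ 3 * C / μ * r := by
    rw [div_mul_eq_mul_div, le_div_iff₀ hμ]
    linarith
  linarith

/-- The primal-dual solution map is locally Lipschitz. -/
theorem locallyLipschitz_of_isKKT (h : P.IsC2) (hμ : 0 < μ) (hc : P.IsStronglyConvexProgram μ)
    {ystar : EuclideanSpace ℝ (Fin dx) → EuclideanSpace ℝ (Fin dy)}
    {om : EuclideanSpace ℝ (Fin dx) → EuclideanSpace ℝ (Fin m) × EuclideanSpace ℝ (Fin n)}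
    (hs : ∀ x, P.IsSolution x (ystar x)) (hl : ∀ x, P.LICQ x (ystar x))
    (hk : ∀ x, P.IsKKT x (ystar x) (om x).1 (om x).2) :
    LocallyLipschitz fun x => (ystar x, om x) := by
  intro x₀
  have hcy : ContinuousAt ystar x₀ := (hk x₀).continuousAt h hμ hc hs (hl x₀)
  have hcw : Tendsto (fun x => (x, ystar x)) (𝓝 x₀) (𝓝 (x₀, ystar x₀)) :=
    tendsto_id.prodMk_nhds hcy
  obtain ⟨c, hc0, hlow⟩ := (hl x₀).exists_le_norm h
  have hΦ : ContDiff ℝ 1 fun w : EuclideanSpace ℝ (Fin dx) × EuclideanSpace ℝ (Fin dy) =>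
      (∇ (P.g w.1) w.2, P.multiplierMap w, P.constraintMap w) :=
    (contDiff_partialGradient h.1).prodMk
      ((contDiff_multiplierMap h).prodMk (contDiff_constraintMap h))
  obtain ⟨K, t, ht, hLip⟩ := (hΦ.contDiffAt (x := (x₀, ystar x₀))).exists_lipschitzOnWith
  -- A product neighbourhood also contains the mixed point `(x₁, ystar x₂)`, where the two KKT
  -- points are compared.
  obtain ⟨U, hU, V, hV, hUV⟩ := mem_nhds_prod_iff.1 ht
  -- Inactive constraints stay inactive nearby, so all nearby multipliers are supported on the
  -- active set of `x₀`, where the lower bound `hlow` applies.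
  have hact : ∀ᶠ x in 𝓝 x₀, ∀ j ∉ P.active x₀ (ystar x₀), (om x).1 j = 0 := by
    refine eventually_all.2 fun j => ?_
    by_cases hj : j ∈ P.active x₀ (ystar x₀)
    · simp [hj]
    · have h1 : Tendsto (fun x => P.p j x (ystar x)) (𝓝 x₀) (𝓝 (P.p j x₀ (ystar x₀))) :=
        ((h.2.1 j).continuous.tendsto (x₀, ystar x₀)).comp hcw
      filter_upwards [h1.eventually_ne fun h => hj (mem_active.2 h)] with x hx _
      exact (hk x).eq_zero_of_notMem_active fun h => hx (mem_active.1 h)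
  have hB : ∀ᶠ x in 𝓝 x₀, ‖∇ (P.g x) (ystar x)‖ < ‖∇ (P.g x₀) (ystar x₀)‖ + 1 := by
    have h1 : Tendsto (fun x => ‖∇ (P.g x) (ystar x)‖) (𝓝 x₀) (𝓝 ‖∇ (P.g x₀) (ystar x₀)‖) :=
      (((contDiff_partialGradient h.1).continuous.tendsto (x₀, ystar x₀)).comp hcw).norm
    exact h1.eventually_lt_const (lt_add_one _)
  -- `B` bounds the nearby multipliers; then `e ≤ D (r + s)` and `μ s² ≤ C r (r + 2 s)`, and `M` is
  -- the resulting constant in `s ≤ M r`.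
  set B := (‖∇ (P.g x₀) (ystar x₀)‖ + 1) / c with hBdef
  have hB0 : 0 ≤ B := by positivity
  set D := K * (1 + B) / c with hD
  have hD0 : 0 ≤ D := by positivity
  set C := D * K + K * (1 + B) with hC
  have hC0 : 0 ≤ C := by positivity
  set M := 1 + 3 * C / μ with hM
  have hM0 : 0 ≤ M := by positivity
  have hgood := (((hcw.eventually hlow).and hact).and hB).and
    ((eventually_mem_set.2 hU).and (hcy hV))
  refine ⟨⟨M + D * (1 + M), by positivity⟩, _, hgood, LipschitzOnWith.of_dist_le_mul ?_⟩
  rintro x₁ ⟨⟨⟨hlow1, hact1⟩, -⟩, hU1, hV1⟩ x₂ ⟨⟨⟨hlow2, hact2⟩, hB2⟩, hU2, hV2⟩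
  have hV1 : ystar x₁ ∈ V := hV1
  have hV2 : ystar x₂ ∈ V := hV2
  have hx₁ : ∇ (P.g x₁) (ystar x₁) + P.multiplierMap (x₁, ystar x₁) (om x₁) = 0 := by
    rw [← (hk x₁).1, gradLagrangian_eq h]
  have hx₂ : ∇ (P.g x₂) (ystar x₂) + P.multiplierMap (x₂, ystar x₂) (om x₂) = 0 := by
    rw [← (hk x₂).1, gradLagrangian_eq h]
  set r := ‖x₁ - x₂‖ with hr
  set s := ‖ystar x₁ - ystar x₂‖ with hs'
  set e := ‖om x₁ - om x₂‖ with he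
  have hr0 : 0 ≤ r := norm_nonneg _
  have hs0 : 0 ≤ s := norm_nonneg _
  have he0 : 0 ≤ e := norm_nonneg _
  have hom2 : ‖om x₂‖ ≤ B := by
    have h1 := hlow2 (om x₂) hact2
    rw [eq_neg_of_add_eq_zero_right hx₂, norm_neg] at h1
    rw [hBdef, le_div_iff₀ hc0]
    linarith
  have hLip' : ∀ w ∈ t, ∀ w' ∈ t, ‖∇ (P.g w.1) w.2 - ∇ (P.g w'.1) w'.2‖ ≤ K * ‖w - w'‖ ∧
      ‖P.multiplierMap w - P.multiplierMap w'‖ ≤ K * ‖w - w'‖ ∧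
      ‖P.constraintMap w - P.constraintMap w'‖ ≤ K * ‖w - w'‖ := by
    intro w hw w' hw'
    have h1 := hLip.norm_sub_le hw hw'
    simp only [Prod.mk_sub_mk] at h1
    exact ⟨(norm_fst_le _).trans h1, ((norm_fst_le _).trans (norm_snd_le _)).trans h1,
      ((norm_snd_le _).trans (norm_snd_le _)).trans h1⟩
  have hgl : ∀ w ∈ t, ∀ w' ∈ t, ‖(∇ (P.g w.1) w.2 + P.multiplierMap w (om x₂)) -
      (∇ (P.g w'.1) w'.2 + P.multiplierMap w' (om x₂))‖ ≤ K * (1 + B) * ‖w - w'‖ := by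
    intro w hw w' hw'
    obtain ⟨h1, h2, -⟩ := hLip' w hw w' hw'
    have h3 := (P.multiplierMap w - P.multiplierMap w').le_of_opNorm_le h2 (om x₂)
    have h4 : K * ‖w - w'‖ * ‖om x₂‖ ≤ K * ‖w - w'‖ * B := by gcongr
    rw [add_sub_add_comm]
    refine (norm_add_le _ _).trans ?_
    rw [sub_apply] at h3
    linarith
  have hw1 : (x₁, ystar x₁) ∈ t := hUV ⟨hU1, hV1⟩
  have hw2 : (x₂, ystar x₂) ∈ t := hUV ⟨hU2, hV2⟩
  have hw12 : (x₁, ystar x₂) ∈ t := hUV ⟨hU1, hV2⟩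
  have hnorm12 : ‖(x₁, ystar x₂) - (x₂, ystar x₂)‖ = r := by
    simp [Prod.norm_def, hr]
  have hnorm : ‖(x₁, ystar x₁) - (x₂, ystar x₂)‖ ≤ r + s := by
    rw [Prod.mk_sub_mk, Prod.norm_def]
    exact max_le (le_add_of_nonneg_right hs0) (le_add_of_nonneg_left hr0)
  have E1 : e ≤ D * (r + s) := by
    have h1 := hlow1 (om x₁ - om x₂) (fun j hj => by simp [hact1 j hj, hact2 j hj])
    have h2 := hgl _ hw1 _ hw2
    -- By stationarity at both points, the change of the Lagrangian gradient with multiplier frozen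
    -- at `om x₂` is minus the multiplier map at the first point applied to `om x₁ - om x₂`.
    have h3 : (∇ (P.g x₁) (ystar x₁) + P.multiplierMap (x₁, ystar x₁) (om x₂)) -
      (∇ (P.g x₂) (ystar x₂) + P.multiplierMap (x₂, ystar x₂) (om x₂)) =
        -(P.multiplierMap (x₁, ystar x₁) (om x₁ - om x₂)) := by
      rw [hx₂, map_sub, eq_neg_of_add_eq_zero_left hx₁]
      abel
    rw [h3, norm_neg] at h2
    have h4 : K * (1 + B) * ‖(x₁, ystar x₁) - (x₂, ystar x₂)‖ ≤ K * (1 + B) * (r + s) := by gcongr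
    rw [hD, div_mul_eq_mul_div, le_div_iff₀ hc0]
    linarith
  have E2 : μ * s ^ 2 ≤ K * r * e + K * (1 + B) * r * s := by
    have h1 := (hk x₁).norm_sq_le h hc (hk x₂)
    have h2 := (hLip' _ hw12 _ hw2).2.2
    have h3 := hgl _ hw12 _ hw2
    rw [hnorm12] at h2 h3
    rw [hx₂, sub_zero] at h3
    have h4 : ‖P.gradLagrangian x₁ (ystar x₂) (om x₂).1 (om x₂).2‖ ≤ K * (1 + B) * r := by
      rw [gradLagrangian_eq h]
      exact h3
    refine h1.trans (add_le_add ?_ ?_)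
    · gcongr
    · gcongr
  have E3 : s ≤ M * r := by
    refine le_mul_of_sq_le hμ hC0 hr0 (E2.trans ?_)
    have h1 : K * r * e ≤ K * r * (D * (r + s)) := by gcongr
    have h2 : 0 ≤ K * r * (1 + B) * (r + s) := by positivity
    have h3 : 0 ≤ D * K * r * s := by positivity
    rw [hC]
    nlinarith
  have E4 : e ≤ D * (1 + M) * r := by
    refine E1.trans ?_
    rw [mul_assoc]
    gcongr
    linarith
  rw [dist_eq_norm, dist_eq_norm, Prod.mk_sub_mk, Prod.norm_def]
  refine max_le ?_ ?_
  · change s ≤ (M + D * (1 + M)) * r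
    have : 0 ≤ D * (1 + M) * r := by positivity
    linarith
  · change e ≤ (M + D * (1 + M)) * r
    have : 0 ≤ M * r := by positivity
    linarith

end ParamProgram

/-! ### The linearised KKT operator and its matrix form. -/

theorem EuclideanSpace.sum_apply_single_mul {a b : ℕ}
    (T : EuclideanSpace ℝ (Fin a) →L[ℝ] EuclideanSpace ℝ (Fin b)) (u : EuclideanSpace ℝ (Fin a))
    (i : Fin b) : ∑ k, T (EuclideanSpace.single k 1) i * u k = T u i := by
  conv_rhs => rw [← (EuclideanSpace.basisFun (Fin a) ℝ).sum_repr u]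
  simp [map_sum, mul_comm]

theorem EuclideanSpace.real_inner_eq_sum_mul {a : ℕ} (v u : EuclideanSpace ℝ (Fin a)) :
    ⟪v, u⟫ = ∑ k, v k * u k := by
  simp [PiLp.inner_apply, mul_comm]

/-- Padding by zero off `S` inverts the stacking, so matrix statements can be moved to the full
multiplier space. -/
theorem exists_reducedVec {dy m n : ℕ} (S : Finset (Fin m)) (v : Fin dy ⊕ (S ⊕ Fin n) → ℝ) :
    ∃ w : EuclideanSpace ℝ (Fin dy) × EuclideanSpace ℝ (Fin m) × EuclideanSpace ℝ (Fin n),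
      reducedVec S w = v ∧ ∀ j ∉ S, w.2.1 j = 0 := by
  refine ⟨(WithLp.toLp 2 fun k => v (Sum.inl k),
    WithLp.toLp 2 fun j => if hj : j ∈ S then v (Sum.inr (Sum.inl ⟨j, hj⟩)) else 0,
    WithLp.toLp 2 fun i => v (Sum.inr (Sum.inr i))), ?_, fun j hj => by simp [hj]⟩
  funext k
  rcases k with k | k | k <;> simp [reducedVec]

namespace ParamProgram

variable {dx dy m n : ℕ} {P : ParamProgram dx dy m n} {μ : ℝ}
  {x d : EuclideanSpace ℝ (Fin dx)} {y u : EuclideanSpace ℝ (Fin dy)}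
  {lam : EuclideanSpace ℝ (Fin m)} {nu : EuclideanSpace ℝ (Fin n)}
  {om : EuclideanSpace ℝ (Fin m) × EuclideanSpace ℝ (Fin n)}

variable (P) in
/-- The joint derivative of the gradient `∇_y L` of the Lagrangian. -/
def derivGrad (x : EuclideanSpace ℝ (Fin dx)) (y : EuclideanSpace ℝ (Fin dy))
    (lam : EuclideanSpace ℝ (Fin m)) (nu : EuclideanSpace ℝ (Fin n)) :
    EuclideanSpace ℝ (Fin dx) ×
      (EuclideanSpace ℝ (Fin dy) × EuclideanSpace ℝ (Fin m) × EuclideanSpace ℝ (Fin n)) →L[ℝ]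
      EuclideanSpace ℝ (Fin dy) :=
  fderiv ℝ (fun w : EuclideanSpace ℝ (Fin dx) ×
        (EuclideanSpace ℝ (Fin dy) × EuclideanSpace ℝ (Fin m) × EuclideanSpace ℝ (Fin n)) =>
      P.gradLagrangian w.1 w.2.1 w.2.2.1 w.2.2.2) (x, (y, lam, nu))

theorem hasFDerivAt_gradLagrangian (h : P.IsC2) :
    HasFDerivAt (fun w : EuclideanSpace ℝ (Fin dx) ×
        (EuclideanSpace ℝ (Fin dy) × EuclideanSpace ℝ (Fin m) × EuclideanSpace ℝ (Fin n)) =>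
      P.gradLagrangian w.1 w.2.1 w.2.2.1 w.2.2.2) (P.derivGrad x y lam nu) (x, (y, lam, nu)) :=
  ((contDiff_gradLagrangian h).differentiable one_ne_zero _).hasFDerivAt

theorem hasFDerivAt_gradLagrangian_y (h : P.IsC2) :
    HasFDerivAt (fun y' => P.gradLagrangian x y' lam nu)
      ((P.derivGrad x y lam nu).comp
        ((ContinuousLinearMap.inr ℝ _ _).comp (ContinuousLinearMap.inl ℝ _ _))) y :=
  (hasFDerivAt_gradLagrangian (x := x) (lam := lam) (nu := nu) h).comp
    (f := fun y' => (x, (y', lam, nu))) y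
    ((hasFDerivAt_prodMk_right x (y, lam, nu)).comp (f := fun y' => (y', lam, nu)) y
      (hasFDerivAt_prodMk_left y (lam, nu)))

theorem hasFDerivAt_gradLagrangian_x (h : P.IsC2) :
    HasFDerivAt (fun x' => P.gradLagrangian x' y lam nu)
      ((P.derivGrad x y lam nu).comp (ContinuousLinearMap.inl ℝ _ _)) x :=
  (hasFDerivAt_gradLagrangian h).comp (f := fun x' => (x', (y, lam, nu))) x
    (hasFDerivAt_prodMk_left x (y, lam, nu))

/-- The Lagrangian gradient is affine in the multipliers, with linear part the multiplier map. -/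
theorem derivGrad_multipliers (h : P.IsC2) :
    P.derivGrad x y lam nu (0, (0, om)) = P.multiplierMap (x, y) om := by
  have h1 : HasFDerivAt (fun om' : EuclideanSpace ℝ (Fin m) × EuclideanSpace ℝ (Fin n) =>
      P.gradLagrangian x y om'.1 om'.2)
      ((P.derivGrad x y lam nu).comp
        ((ContinuousLinearMap.inr ℝ _ _).comp (ContinuousLinearMap.inr ℝ _ _))) (lam, nu) :=
    (hasFDerivAt_gradLagrangian (x := x) (y := y) h).comp
      (f := fun om' : EuclideanSpace ℝ (Fin m) × EuclideanSpace ℝ (Fin n) => (x, (y, om')))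
      (lam, nu)
      ((hasFDerivAt_prodMk_right x (y, (lam, nu))).comp (f := fun om' => (y, om')) (lam, nu)
        (hasFDerivAt_prodMk_right y (lam, nu)))
  have h2 : HasFDerivAt (fun om' : EuclideanSpace ℝ (Fin m) × EuclideanSpace ℝ (Fin n) =>
      P.gradLagrangian x y om'.1 om'.2) (P.multiplierMap (x, y)) (lam, nu) := by
    simp only [gradLagrangian_eq h]
    exact (P.multiplierMap (x, y)).hasFDerivAt.const_add _
  exact congrArg (fun T => T om) (h1.unique h2)

/-- The Hessian of the Lagrangian is uniformly positive definite. -/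
theorem le_inner_derivGrad (h : P.IsC2) (hc : P.IsStronglyConvexProgram μ)
    (hlam : ∀ j, 0 ≤ lam j) :
    μ * ‖u‖ ^ 2 ≤ ⟪P.derivGrad x y lam nu (0, (u, 0)), u⟫ := by
  have hline : HasDerivAt (fun t : ℝ => P.gradLagrangian x (y + t • u) lam nu)
      (P.derivGrad x y lam nu (0, (u, 0))) 0 := by
    have h1 : HasDerivAt (fun t : ℝ => y + t • u) u 0 := by
      simpa using ((hasDerivAt_id (0 : ℝ)).smul_const u).const_add y
    have h2 := hasFDerivAt_gradLagrangian_y (x := x) (y := y) (lam := lam) (nu := nu) h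
    rw [show y = y + (0 : ℝ) • u by simp] at h2
    have h3 := h2.comp_hasDerivAt (0 : ℝ) h1
    rw [show y + (0 : ℝ) • u = y by simp] at h3
    exact h3
  have hlim : Tendsto (fun t : ℝ => ⟪t⁻¹ • (P.gradLagrangian x (y + t • u) lam nu -
      P.gradLagrangian x y lam nu), u⟫) (𝓝[>] 0)
      (𝓝 ⟪P.derivGrad x y lam nu (0, (u, 0)), u⟫) := by
    have := hline.tendsto_slope_zero_right
    simp only [zero_add, zero_smul, add_zero] at this
    exact this.inner tendsto_const_nhds
  refine ge_of_tendsto hlim ?_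
  filter_upwards [self_mem_nhdsWithin] with t ht
  have ht : 0 < t := ht
  -- The gradient inequality in both directions between `y` and `y + t u` gives strong monotonicity
  -- of the gradient; dividing by `t²` and letting `t → 0⁺` bounds the Hessian.
  have a1 := lagrangian_add_le (x := x) (y := y) (nu := nu) h hc hlam (y + t • u)
  have a2 := lagrangian_add_le (x := x) (y := y + t • u) (nu := nu) h hc hlam y
  simp only [add_sub_cancel_left, sub_add_cancel_left, norm_neg, inner_neg_right, norm_smul,
    real_inner_smul_right, mul_pow, Real.norm_eq_abs, sq_abs] at a1 a2
  rw [real_inner_smul_left, inner_sub_left, ← div_eq_inv_mul, le_div_iff₀ ht]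
  have a3 : t * (μ * ‖u‖ ^ 2 * t) ≤ t * (⟪P.gradLagrangian x (y + t • u) lam nu, u⟫ -
      ⟪P.gradLagrangian x y lam nu, u⟫) := by nlinarith
  exact le_of_mul_le_mul_left a3 ht

/-- Injectivity of the linearised KKT system. -/
theorem LICQ.eq_zero_of_derivGrad (h : P.IsC2) (hμ : 0 < μ) (hc : P.IsStronglyConvexProgram μ)
    (hl : P.LICQ x y) (hlam : ∀ j, 0 ≤ lam j)
    (hs : ∀ j ∉ P.active x y, om.1 j = 0)
    (h0 : P.derivGrad x y lam nu (0, (u, om)) = 0)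
    (hp : ∀ j, 0 ≤ om.1 j * ⟪∇ (P.p j x) y, u⟫) (hq : ∀ i, ⟪∇ (P.q i x) y, u⟫ = 0) :
    u = 0 ∧ om = 0 := by
  have hsplit : P.derivGrad x y lam nu (0, (u, om)) =
      P.derivGrad x y lam nu (0, (u, 0)) + P.multiplierMap (x, y) om := by
    rw [← derivGrad_multipliers (lam := lam) (nu := nu) h, ← map_add]
    simp
  have h1 := le_inner_derivGrad (x := x) (y := y) (u := u) (nu := nu) h hc hlam
  have h2 : 0 ≤ ⟪P.multiplierMap (x, y) om, u⟫ := by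
    rw [multiplierMap_apply, inner_add_left, sum_inner, sum_inner]
    simp only [real_inner_smul_left, hq, mul_zero, Finset.sum_const_zero, add_zero]
    exact Finset.sum_nonneg fun j _ => hp j
  -- Paired with `u`, stationarity writes zero as a Hessian term at least `μ ‖u‖²` plus a
  -- nonnegative constraint term. Requiring only a sign in `hp` covers both the kernel of the matrix
  -- and the difference of two complementarity solutions.
  have h3 : ⟪P.derivGrad x y lam nu (0, (u, 0)), u⟫ + ⟪P.multiplierMap (x, y) om, u⟫ = 0 := by
    rw [← inner_add_left, ← hsplit, h0, inner_zero_left]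
  have hu : u = 0 := by
    have h4 : ‖u‖ ^ 2 ≤ 0 := by nlinarith
    have h5 : ‖u‖ = 0 := by nlinarith [norm_nonneg u]
    exact norm_eq_zero.1 h5
  refine ⟨hu, hl.eq_zero hs ?_⟩
  subst hu
  rw [← h0, derivGrad_multipliers h]

/-- The matrix sees only the multipliers indexed by `S`; vanishing off `S` lets the sum over `S` be
completed to the full multiplier map. -/
theorem kktM_mulVec (h : P.IsC2) {S : Finset (Fin m)} (hs : ∀ j ∉ S, om.1 j = 0) :
    (P.kktM S x y lam nu).mulVec (reducedVec S (u, om)) =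
      Sum.elim (fun k => P.derivGrad x y lam nu (0, (u, om)) k)
        (Sum.elim (fun j : S => ⟪∇ (P.p j x) y, u⟫) (fun i => ⟪∇ (P.q i x) y, u⟫)) := by
  have hsplit : P.derivGrad x y lam nu (0, (u, om)) =
      P.derivGrad x y lam nu (0, (u, 0)) + P.multiplierMap (x, y) om := by
    rw [← derivGrad_multipliers (lam := lam) (nu := nu) h, ← map_add]
    simp
  have hH : ∀ k, ∑ i, P.hessYY x y lam nu k i * u i = P.derivGrad x y lam nu (0, (u, 0)) k := by
    intro k
    simp only [hessYY, Matrix.of_apply]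
    rw [EuclideanSpace.sum_apply_single_mul, (hasFDerivAt_gradLagrangian_y h).fderiv]
    rfl
  funext k
  rcases k with k | k | k
  · simp only [kktM, Matrix.mulVec, dotProduct, Fintype.sum_sum_type, Matrix.fromBlocks_apply₁₁,
      Matrix.fromBlocks_apply₁₂, reducedVec, Sum.elim_inl, Sum.elim_inr, hH,
      Matrix.transpose_apply, jacY, Matrix.fromRows_apply_inl, Matrix.fromRows_apply_inr,
      Matrix.of_apply]
    rw [hsplit, multiplierMap_apply,
      Finset.sum_coe_sort S (fun j => (∇ (P.p j x) y) k * om.1 j),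
      Finset.sum_subset (Finset.subset_univ S) (fun j _ hj => by rw [hs j hj, mul_zero])]
    simp [mul_comm]
  · simp only [EuclideanSpace.real_inner_eq_sum_mul, Sum.elim_inr, Sum.elim_inl]
    simp [kktM, Matrix.mulVec, dotProduct, reducedVec, jacY]
  · simp only [EuclideanSpace.real_inner_eq_sum_mul, Sum.elim_inr]
    simp [kktM, Matrix.mulVec, dotProduct, reducedVec, jacY]

theorem kktN_mulVec (h : P.IsC2) {S : Finset (Fin m)} :
    (P.kktN S x y lam nu).mulVec d.ofLp =
      Sum.elim (fun k => P.derivGrad x y lam nu (d, 0) k)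
        (Sum.elim (fun j : S => ⟪∇ (fun x' => P.p j x' y) x, d⟫)
          (fun i => ⟪∇ (fun x' => P.q i x' y) x, d⟫)) := by
  have hH : ∀ k, ∑ i, P.hessXY x y lam nu k i * d i = P.derivGrad x y lam nu (d, 0) k := by
    intro k
    simp only [hessXY, Matrix.of_apply]
    rw [EuclideanSpace.sum_apply_single_mul, (hasFDerivAt_gradLagrangian_x h).fderiv]
    rfl
  funext k
  rcases k with k | k | k
  · exact hH k
  · simp only [EuclideanSpace.real_inner_eq_sum_mul, Sum.elim_inr, Sum.elim_inl]
    simp [kktN, Matrix.mulVec, dotProduct, jacX]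
  · simp only [EuclideanSpace.real_inner_eq_sum_mul, Sum.elim_inr]
    simp [kktN, Matrix.mulVec, dotProduct, jacX]

/-- The reduced KKT matrix is nonsingular. -/
theorem isUnit_kktM (h : P.IsC2) (hμ : 0 < μ) (hc : P.IsStronglyConvexProgram μ)
    (hl : P.LICQ x y) (hlam : ∀ j, 0 ≤ lam j) {S : Finset (Fin m)} (hS : S ⊆ P.active x y) :
    IsUnit (P.kktM S x y lam nu) := by
  rw [← Matrix.mulVec_injective_iff_isUnit,
    ← Matrix.coe_mulVecLin, ← LinearMap.ker_eq_bot, LinearMap.ker_eq_bot']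
  intro v hv
  obtain ⟨⟨u, om⟩, rfl, hw⟩ := exists_reducedVec S v
  rw [Matrix.mulVecLin_apply, kktM_mulVec h hw] at hv
  obtain ⟨rfl, rfl⟩ := hl.eq_zero_of_derivGrad (u := u) (om := om) (nu := nu) h hμ hc hlam
    (fun j hj => hw j fun hjS => hj (hS hjS))
    (by ext k; exact congrFun hv (Sum.inl k))
    (fun j => by
      by_cases hj : j ∈ S
      · have := congrFun hv (Sum.inr (Sum.inl ⟨j, hj⟩))
        simp only [Sum.elim_inr, Sum.elim_inl, Pi.zero_apply] at this
        rw [this, mul_zero]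
      · rw [hw j hj, zero_mul])
    (fun i => congrFun hv (Sum.inr (Sum.inr i)))
  funext k
  rcases k with k | k | k <;> simp [reducedVec]

variable (P) in
/-- The joint derivative of `p_j`. -/
def derivP (j : Fin m) (x : EuclideanSpace ℝ (Fin dx)) (y : EuclideanSpace ℝ (Fin dy)) :
    EuclideanSpace ℝ (Fin dx) × EuclideanSpace ℝ (Fin dy) →L[ℝ] ℝ :=
  fderiv ℝ (fun w : EuclideanSpace ℝ (Fin dx) × EuclideanSpace ℝ (Fin dy) => P.p j w.1 w.2) (x, y)

variable (P) in
/-- The joint derivative of `q_i`. -/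
def derivQ (i : Fin n) (x : EuclideanSpace ℝ (Fin dx)) (y : EuclideanSpace ℝ (Fin dy)) :
    EuclideanSpace ℝ (Fin dx) × EuclideanSpace ℝ (Fin dy) →L[ℝ] ℝ :=
  fderiv ℝ (fun w : EuclideanSpace ℝ (Fin dx) × EuclideanSpace ℝ (Fin dy) => P.q i w.1 w.2) (x, y)

theorem derivP_apply (h : P.IsC2) (j : Fin m) :
    P.derivP j x y (d, u) = ⟪∇ (fun x' => P.p j x' y) x, d⟫ + ⟪∇ (P.p j x) y, u⟫ := by
  rw [inner_partialGradient_fst (h.differentiableAt_p j _),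
    inner_partialGradient_snd (h.differentiableAt_p j _), ← map_add]
  simp [derivP]

theorem derivQ_apply (h : P.IsC2) (i : Fin n) :
    P.derivQ i x y (d, u) = ⟪∇ (fun x' => P.q i x' y) x, d⟫ + ⟪∇ (P.q i x) y, u⟫ := by
  rw [inner_partialGradient_fst (h.differentiableAt_q i _),
    inner_partialGradient_snd (h.differentiableAt_q i _), ← map_add]
  simp [derivQ]

/-- A solution of the reduced linear system is given by the inverse of the reduced KKT matrix. -/
theorem reducedVec_eq (h : P.IsC2) {S : Finset (Fin m)} (hM : IsUnit (P.kktM S x y lam nu))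
    (hs : ∀ j ∉ S, om.1 j = 0) (h0 : P.derivGrad x y lam nu (d, (u, om)) = 0)
    (hp : ∀ j ∈ S, P.derivP j x y (d, u) = 0) (hq : ∀ i, P.derivQ i x y (d, u) = 0) :
    reducedVec S (u, om) =
      (-((P.kktM S x y lam nu)⁻¹ * P.kktN S x y lam nu)).mulVec d.ofLp := by
  have hsum : (P.kktM S x y lam nu).mulVec (reducedVec S (u, om)) =
      -(P.kktN S x y lam nu).mulVec d.ofLp := by
    rw [kktM_mulVec h hs, kktN_mulVec h]
    funext k
    rcases k with k | k | k
    · have h1 : P.derivGrad x y lam nu (0, (u, om)) + P.derivGrad x y lam nu (d, 0) = 0 := by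
        rw [← map_add, ← h0]; simp
      rw [eq_neg_of_add_eq_zero_left h1]
      simp
    · have h1 := hp k k.2
      rw [derivP_apply h] at h1
      simp only [Sum.elim_inr, Sum.elim_inl, Pi.neg_apply]
      linarith
    · have h1 := hq k
      rw [derivQ_apply h] at h1
      simp only [Sum.elim_inr, Pi.neg_apply]
      linarith
  have hdet := (Matrix.isUnit_iff_isUnit_det _).1 hM
  rw [Matrix.neg_mulVec, ← Matrix.mulVec_mulVec, ← Matrix.mulVec_neg, ← hsum, Matrix.mulVec_mulVec,
    Matrix.nonsing_inv_mul _ hdet, Matrix.one_mulVec]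

end ParamProgram

/-! ### Directional derivatives, and smoothness under strict complementarity. -/

/-- Chain rule for one-sided difference quotients along a curve `h ↦ (x + h d, z (x + h d))`. -/
theorem HasFDerivAt.tendsto_graph_quotient {X Z E : Type*} [NormedAddCommGroup X] [NormedSpace ℝ X]
    [NormedAddCommGroup Z] [NormedSpace ℝ Z] [NormedAddCommGroup E] [NormedSpace ℝ E]
    {Φ : X × Z → E} {Φ' : X × Z →L[ℝ] E} {z : X → Z} {x d : X} {w : Z} {l : Filter ℝ}
    (hΦ : HasFDerivAt Φ Φ' (x, z x)) (hz : ContinuousAt z x) (hl : l ≤ 𝓝[>] 0)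
    (hw : Tendsto (fun h : ℝ => h⁻¹ • (z (x + h • d) - z x)) l (𝓝 w)) :
    Tendsto (fun h : ℝ => h⁻¹ • (Φ (x + h • d, z (x + h • d)) - Φ (x, z x))) l
      (𝓝 (Φ' (d, w))) := by
  have hl0 : Tendsto (fun h : ℝ => h) l (𝓝 0) := tendsto_id'.2 (hl.trans nhdsWithin_le_nhds)
  have h1 : Tendsto (fun h : ℝ => h • d) l (𝓝 0) := by
    simpa using hl0.smul_const d
  have h2 : Tendsto (fun h : ℝ => z (x + h • d) - z x) l (𝓝 0) := by
    have h3 : Tendsto (fun h : ℝ => x + h • d) l (𝓝 x) := by simpa using h1.const_add x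
    simpa using (hz.tendsto.comp h3).sub_const (z x)
  have h3 : Tendsto (fun h : ℝ => h⁻¹ • (h • d)) l (𝓝 d) := by
    refine tendsto_const_nhds.congr' ?_
    filter_upwards [hl self_mem_nhdsWithin] with h hh
    rw [smul_smul, inv_mul_cancel₀ (ne_of_gt hh), one_smul]
  have h4 := (hasFDerivWithinAt_univ.2 hΦ).lim (c := fun h : ℝ => h⁻¹)
    (d := fun h : ℝ => (h • d, z (x + h • d) - z x)) (v := (d, w)) (l := l)
    (h1.prodMk_nhds h2) (by simp) (h3.prodMk_nhds hw)
  simpa using h4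

/-- A continuous curve along which a `C¹` map with injective derivative is `C¹` is itself `C¹`. -/
theorem ContDiffAt.of_comp_of_injective {X A B : Type*} [NormedAddCommGroup X] [NormedSpace ℝ X]
    [NormedAddCommGroup A] [NormedSpace ℝ A] [FiniteDimensional ℝ A]
    [NormedAddCommGroup B] [NormedSpace ℝ B] [FiniteDimensional ℝ B]
    {F : A → B} {F' : A →L[ℝ] B} {γ : X → A} {c : X → B} {x : X}
    (hF : ContDiffAt ℝ 1 F (γ x)) (hF' : HasFDerivAt F F' (γ x)) (hinj : Function.Injective F')
    (hdim : Module.finrank ℝ A = Module.finrank ℝ B) (hγ : ContinuousAt γ x)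
    (hc : ContDiffAt ℝ 1 c x) (heq : ∀ᶠ x' in 𝓝 x, F (γ x') = c x') : ContDiffAt ℝ 1 γ x := by
  let L := (LinearEquiv.ofInjectiveOfFinrankEq F'.toLinearMap hinj hdim).toContinuousLinearEquiv
  have hL : HasFDerivAt F (L : A →L[ℝ] B) (γ x) := by
    have : (L : A →L[ℝ] B) = F' := ContinuousLinearMap.ext fun _ => rfl
    rwa [this]
  have : CompleteSpace A := FiniteDimensional.complete ℝ A
  have hloc := hF.to_localInverse hL one_ne_zero
  have hleft := (hF.hasStrictFDerivAt' hL one_ne_zero).eventually_left_inverse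
  rw [heq.self_of_nhds] at hloc
  refine (hloc.comp x hc).congr_of_eventuallyEq ?_
  -- Continuity of `γ` keeps `γ x'` where the local inverse undoes `F`, so `γ` is the local inverse
  -- composed with `c`.
  filter_upwards [hγ.eventually hleft, heq] with x' h1 h2
  rw [h2] at h1
  exact h1.symm

namespace ParamProgram

variable {dx dy m n : ℕ} {P : ParamProgram dx dy m n} {μ : ℝ}
  {x d : EuclideanSpace ℝ (Fin dx)} {y : EuclideanSpace ℝ (Fin dy)}
  {lam : EuclideanSpace ℝ (Fin m)} {nu : EuclideanSpace ℝ (Fin n)}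

variable (P) in
/-- The KKT system linearised in the direction `d`: the optimality conditions of the quadratic
program whose solution is the directional derivative of the primal-dual solution. -/
structure IsLinearizedKKT (x d : EuclideanSpace ℝ (Fin dx)) (y : EuclideanSpace ℝ (Fin dy))
    (lam : EuclideanSpace ℝ (Fin m)) (nu : EuclideanSpace ℝ (Fin n))
    (w : EuclideanSpace ℝ (Fin dy) × EuclideanSpace ℝ (Fin m) × EuclideanSpace ℝ (Fin n)) :
    Prop where
  stationary : P.derivGrad x y lam nu (d, w) = 0
  equality : ∀ i, P.derivQ i x y (d, w.1) = 0
  inactive : ∀ j ∉ P.active x y, w.2.1 j = 0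
  strictlyActive : ∀ j ∈ P.strictlyActive x y lam, P.derivP j x y (d, w.1) = 0
  weaklyActive : ∀ j ∈ P.weaklyActive x y lam, 0 ≤ w.2.1 j ∧ P.derivP j x y (d, w.1) ≤ 0 ∧
    w.2.1 j * P.derivP j x y (d, w.1) = 0

theorem mem_weaklyActive {j : Fin m} :
    j ∈ P.weaklyActive x y lam ↔ j ∈ P.active x y ∧ ¬ 0 < lam j := by
  simp only [ParamProgram.weaklyActive, ParamProgram.strictlyActive, Finset.mem_sdiff, Finset.mem_filter]
  tauto

theorem mem_strictlyActive {j : Fin m} :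
    j ∈ P.strictlyActive x y lam ↔ j ∈ P.active x y ∧ 0 < lam j := by
  simp [ParamProgram.strictlyActive]

theorem mem_weaklyActivePos {ystar : EuclideanSpace ℝ (Fin dx) → EuclideanSpace ℝ (Fin dy)}
    {lam : EuclideanSpace ℝ (Fin dx) → EuclideanSpace ℝ (Fin m)} {j : Fin m} :
    j ∈ P.weaklyActivePos ystar lam x d ↔ j ∈ P.weaklyActive x (ystar x) (lam x) ∧
      ∃ ε₀ : ℝ, 0 < ε₀ ∧ ∀ ε : ℝ, 0 < ε → ε < ε₀ →
        P.p j (x + ε • d) (ystar (x + ε • d)) = 0 ∧ 0 < lam (x + ε • d) j := by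
  simp [weaklyActivePos]

/-- The linearised KKT system has at most one solution. -/
theorem IsLinearizedKKT.unique (h : P.IsC2) (hμ : 0 < μ) (hc : P.IsStronglyConvexProgram μ)
    (hl : P.LICQ x y) (hlam : ∀ j, 0 ≤ lam j)
    {w w' : EuclideanSpace ℝ (Fin dy) × EuclideanSpace ℝ (Fin m) × EuclideanSpace ℝ (Fin n)}
    (hw : P.IsLinearizedKKT x d y lam nu w) (hw' : P.IsLinearizedKKT x d y lam nu w') : w = w' := by
  have hp : ∀ j, ⟪∇ (P.p j x) y, w.1 - w'.1⟫ =
      P.derivP j x y (d, w.1) - P.derivP j x y (d, w'.1) := fun j => by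
    rw [derivP_apply h, derivP_apply h, inner_sub_right]; ring
  obtain ⟨h1, h2⟩ := hl.eq_zero_of_derivGrad (u := w.1 - w'.1) (om := w.2 - w'.2) (nu := nu)
    h hμ hc hlam (fun j hj => by simp [hw.inactive j hj, hw'.inactive j hj])
    (by
      have h3 : P.derivGrad x y lam nu ((d, w) - (d, w')) = 0 := by
        rw [map_sub, hw.stationary, hw'.stationary, sub_zero]
      have h4 : (d, w) - (d, w') = (0, (w.1 - w'.1, w.2 - w'.2)) := Prod.ext (sub_self d) rfl
      rwa [h4] at h3)
    (fun j => by
      rw [hp]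
      by_cases hj : j ∈ P.active x y
      · by_cases hj' : 0 < lam j
        · have hm := mem_strictlyActive.2 ⟨hj, hj'⟩
          simp [hw.strictlyActive j hm, hw'.strictlyActive j hm]
        · have hm := mem_weaklyActive.2 ⟨hj, hj'⟩
          obtain ⟨a1, a2, a3⟩ := hw.weaklyActive j hm
          obtain ⟨b1, b2, b3⟩ := hw'.weaklyActive j hm
          -- On expanding, the two diagonal products vanish by complementarity, and the cross
          -- products have opposite-signed factors and enter with a minus sign.
          change 0 ≤ (w.2.1 j - w'.2.1 j) * _
          nlinarith [mul_nonneg a1 (neg_nonneg.2 b2), mul_nonneg b1 (neg_nonneg.2 a2)]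
      · simp [hw.inactive j hj, hw'.inactive j hj])
    (fun i => by
      have e1 := hw.equality i
      have e2 := hw'.equality i
      rw [derivQ_apply h] at e1 e2
      rw [inner_sub_right]
      linarith)
  exact Prod.ext (sub_eq_zero.1 h1) (sub_eq_zero.1 h2)

section Path

variable {z : EuclideanSpace ℝ (Fin dx) →
    EuclideanSpace ℝ (Fin dy) × EuclideanSpace ℝ (Fin m) × EuclideanSpace ℝ (Fin n)}

/-- The filter `l` is arbitrary below `𝓝[>] 0` so that the ultrafilters realising cluster points are
allowed. -/
theorem tendsto_quotient_p (h : P.IsC2) (hz : ContinuousAt z x) {l : Filter ℝ} (hl : l ≤ 𝓝[>] 0)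
    {w : EuclideanSpace ℝ (Fin dy) × EuclideanSpace ℝ (Fin m) × EuclideanSpace ℝ (Fin n)}
    (hw : Tendsto (fun h : ℝ => h⁻¹ • (z (x + h • d) - z x)) l (𝓝 w)) (j : Fin m) :
    Tendsto (fun h : ℝ => h⁻¹ • (P.p j (x + h • d) (z (x + h • d)).1 - P.p j x (z x).1)) l
      (𝓝 (P.derivP j x (z x).1 (d, w.1))) :=
  HasFDerivAt.tendsto_graph_quotient (z := fun x => (z x).1)
    (h.differentiableAt_p j (x, (z x).1)).hasFDerivAt hz.fst hl (hw.fst_nhds)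

/-- Every limit of difference quotients of the primal-dual solution solves the linearised KKT
system. -/
theorem isLinearizedKKT_of_tendsto (h : P.IsC2) (hz : ContinuousAt z x)
    (hk : ∀ x, P.IsKKT x (z x).1 (z x).2.1 (z x).2.2) {l : Filter ℝ} [l.NeBot] (hl : l ≤ 𝓝[>] 0)
    {w : EuclideanSpace ℝ (Fin dy) × EuclideanSpace ℝ (Fin m) × EuclideanSpace ℝ (Fin n)}
    (hw : Tendsto (fun h : ℝ => h⁻¹ • (z (x + h • d) - z x)) l (𝓝 w)) :
    P.IsLinearizedKKT x d (z x).1 (z x).2.1 (z x).2.2 w := by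
  have hpos : ∀ᶠ t : ℝ in l, 0 < t := hl self_mem_nhdsWithin
  have hlim : Tendsto (fun t : ℝ => x + t • d) l (𝓝 x) := by
    have h0 : Tendsto (fun t : ℝ => t) l (𝓝 0) := tendsto_id'.2 (hl.trans nhdsWithin_le_nhds)
    simpa using (h0.smul_const d).const_add x
  have hzlim : Tendsto (fun t : ℝ => z (x + t • d)) l (𝓝 (z x)) := hz.tendsto.comp hlim
  have hlamq : ∀ j, Tendsto (fun t : ℝ => t⁻¹ * ((z (x + t • d)).2.1 j - (z x).2.1 j)) l
      (𝓝 (w.2.1 j)) := fun j =>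
    ((EuclideanSpace.proj j : EuclideanSpace ℝ (Fin m) →L[ℝ] ℝ).continuous.tendsto _).comp
      hw.snd_nhds.fst_nhds
  have hlam : ∀ j, Tendsto (fun t : ℝ => (z (x + t • d)).2.1 j) l (𝓝 ((z x).2.1 j)) := fun j =>
    ((EuclideanSpace.proj j : EuclideanSpace ℝ (Fin m) →L[ℝ] ℝ).continuous.tendsto _).comp
      hzlim.snd_nhds.fst_nhds
  have hpq := fun j => tendsto_quotient_p (P := P) h hz hl hw j
  simp only [smul_eq_mul] at hpq
  refine ⟨?_, fun i => ?_, fun j hj => ?_, fun j hj => ?_, fun j hj => ?_⟩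
  · have h1 := HasFDerivAt.tendsto_graph_quotient (z := z)
      (hasFDerivAt_gradLagrangian (x := x) (y := (z x).1) (lam := (z x).2.1) (nu := (z x).2.2) h)
      hz hl hw
    refine tendsto_nhds_unique h1 (tendsto_const_nhds.congr fun t => ?_)
    have e1 := (hk (x + t • d)).1
    have e2 := (hk x).1
    simp only [e1, e2, sub_zero, smul_zero]
  · have h1 := HasFDerivAt.tendsto_graph_quotient (z := fun x => (z x).1)
      (h.differentiableAt_q i (x, (z x).1)).hasFDerivAt hz.fst hl (hw.fst_nhds)
    refine tendsto_nhds_unique h1 (tendsto_const_nhds.congr fun t => ?_)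
    simp [(hk _).2.2.1]
  · have h1 : Tendsto (fun t : ℝ => P.p j (x + t • d) (z (x + t • d)).1) l (𝓝 (P.p j x (z x).1)) :=
      ((h.2.1 j).continuous.tendsto (x, (z x).1)).comp (hlim.prodMk_nhds hzlim.fst_nhds)
    refine tendsto_nhds_unique (hlamq j) (tendsto_const_nhds.congr' ?_)
    filter_upwards [h1.eventually_ne fun h => hj (mem_active.2 h)] with t ht
    rw [(hk x).eq_zero_of_notMem_active hj,
      (hk (x + t • d)).eq_zero_of_notMem_active fun h => ht (mem_active.1 h)]
    simp
  · obtain ⟨hj, hj'⟩ := mem_strictlyActive.1 hj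
    refine tendsto_nhds_unique (hpq j) (tendsto_const_nhds.congr' ?_)
    filter_upwards [(hlam j).eventually_const_lt hj'] with t ht
    rw [mem_active.1 hj, (mul_eq_zero.1 ((hk (x + t • d)).2.2.2.2 j)).resolve_left ht.ne']
    simp
  · obtain ⟨hj, hj'⟩ := mem_weaklyActive.1 hj
    have hl0 : (z x).2.1 j = 0 := le_antisymm (not_lt.1 hj') ((hk x).2.2.2.1 j)
    have hp0 := mem_active.1 hj
    have h1 := hlamq j
    have h2 := hpq j
    simp only [hl0, hp0, sub_zero] at h1 h2
    refine ⟨ge_of_tendsto h1 ?_, le_of_tendsto h2 ?_, ?_⟩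
    · filter_upwards [hpos] with t ht
      exact mul_nonneg (inv_pos.2 ht).le ((hk _).2.2.2.1 j)
    · filter_upwards [hpos] with t ht
      exact mul_nonpos_of_nonneg_of_nonpos (inv_pos.2 ht).le ((hk _).2.1 j)
    -- Both `lam_j` and `p_j` vanish at `x`, so the product of the quotients is `t⁻² lam_j p_j`,
    -- identically zero by complementarity.
    · refine tendsto_nhds_unique (h1.mul h2) (tendsto_const_nhds.congr fun t => ?_)
      rw [mul_mul_mul_comm, (hk (x + t • d)).2.2.2.2 j, mul_zero]

/-- The primal-dual solution map is directionally differentiable. -/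
theorem exists_hasDirDeriv (h : P.IsC2) (hμ : 0 < μ) (hc : P.IsStronglyConvexProgram μ)
    (hz : LocallyLipschitz z) (hk : ∀ x, P.IsKKT x (z x).1 (z x).2.1 (z x).2.2)
    (hl : P.LICQ x (z x).1) (d : EuclideanSpace ℝ (Fin dx)) : ∃ w, HasDirDeriv z x d w := by
  have hcont : ContinuousAt z x := hz.continuous.continuousAt
  obtain ⟨K, t, ht, hK⟩ := hz x
  have hbdd : ∀ᶠ s : ℝ in 𝓝[>] 0, s⁻¹ • (z (x + s • d) - z x) ∈ Metric.closedBall 0 (K * ‖d‖) := by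
    have hlim : Tendsto (fun s : ℝ => x + s • d) (𝓝[>] 0) (𝓝 x) := by
      have h0 : Tendsto (fun s : ℝ => s) (𝓝[>] 0) (𝓝 0) := tendsto_id'.2 nhdsWithin_le_nhds
      simpa using (h0.smul_const d).const_add x
    filter_upwards [hlim ht, self_mem_nhdsWithin] with s hs hs0
    have hs0 : 0 < s := hs0
    have h1 := hK.norm_sub_le hs (mem_of_mem_nhds ht)
    rw [add_sub_cancel_left, norm_smul, Real.norm_of_nonneg hs0.le] at h1
    rw [mem_closedBall_zero_iff, norm_smul, norm_inv, Real.norm_of_nonneg hs0.le,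
      inv_mul_le_iff₀ hs0]
    linarith
  have hcomp := isCompact_closedBall
    (0 : EuclideanSpace ℝ (Fin dy) × EuclideanSpace ℝ (Fin m) × EuclideanSpace ℝ (Fin n)) (K * ‖d‖)
  have hcluster : ∀ w, MapClusterPt w (𝓝[>] 0) (fun s : ℝ => s⁻¹ • (z (x + s • d) - z x)) →
      P.IsLinearizedKKT x d (z x).1 (z x).2.1 (z x).2.2 w := by
    intro w hw
    obtain ⟨U, hU, hUw⟩ := mapClusterPt_iff_ultrafilter.1 hw
    exact isLinearizedKKT_of_tendsto h hcont hk hU hUw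
  -- Compactness provides a cluster point, and uniqueness for the linearised system makes it the
  -- only one; this forces convergence.
  obtain ⟨w, -, hw⟩ := hcomp.exists_mapClusterPt (tendsto_principal.2 hbdd)
  exact ⟨w, hcomp.tendsto_nhds_of_unique_mapClusterPt hbdd fun w' _ hw' =>
    (hcluster w' hw').unique h hμ hc hl (hk x).2.2.2.1 (hcluster w hw)⟩

theorem derivP_eq_zero_of_mem_weaklyActivePos (h : P.IsC2) (hz : ContinuousAt z x)
    {ystar : EuclideanSpace ℝ (Fin dx) → EuclideanSpace ℝ (Fin dy)}
    {lam : EuclideanSpace ℝ (Fin dx) → EuclideanSpace ℝ (Fin m)}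
    {nu : EuclideanSpace ℝ (Fin dx) → EuclideanSpace ℝ (Fin n)}
    (hzeq : z = fun x => (ystar x, lam x, nu x))
    {w : EuclideanSpace ℝ (Fin dy) × EuclideanSpace ℝ (Fin m) × EuclideanSpace ℝ (Fin n)}
    (hw : HasDirDeriv z x d w) {j : Fin m} (hj : j ∈ P.weaklyActivePos ystar lam x d) :
    P.derivP j x (ystar x) (d, w.1) = 0 := by
  subst hzeq
  obtain ⟨hjw, ε, hε, hj⟩ := mem_weaklyActivePos.1 hj
  refine tendsto_nhds_unique (tendsto_quotient_p (P := P) h hz le_rfl hw j)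
    (tendsto_const_nhds.congr' ?_)
  filter_upwards [Ioo_mem_nhdsGT hε] with t ht
  simp [(hj t ht.1 ht.2).1, mem_active.1 (mem_weaklyActive.1 hjw).1]

/-- By complementarity `lam_j > 0` already forces `p_j = 0`, so failure of the `J⁰₊` condition means
that `lam_j` vanishes at arbitrarily small steps. As the limit of the quotients exists, it can be
computed along those steps. -/
theorem eq_zero_of_mem_weaklyActiveNeg
    {ystar : EuclideanSpace ℝ (Fin dx) → EuclideanSpace ℝ (Fin dy)}
    {lam : EuclideanSpace ℝ (Fin dx) → EuclideanSpace ℝ (Fin m)}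
    {nu : EuclideanSpace ℝ (Fin dx) → EuclideanSpace ℝ (Fin n)}
    (hzeq : z = fun x => (ystar x, lam x, nu x)) (hk : ∀ x, P.IsKKT x (ystar x) (lam x) (nu x))
    {w : EuclideanSpace ℝ (Fin dy) × EuclideanSpace ℝ (Fin m) × EuclideanSpace ℝ (Fin n)}
    (hw : HasDirDeriv z x d w) {j : Fin m} (hj : j ∈ P.weaklyActiveNeg ystar lam x d) :
    w.2.1 j = 0 := by
  subst hzeq
  obtain ⟨hjw, hj⟩ := Finset.mem_sdiff.1 hj
  have hl0 : lam x j = 0 := le_antisymm (not_lt.1 (mem_weaklyActive.1 hjw).2) ((hk x).2.2.2.1 j)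
  have hfreq : ∃ᶠ t : ℝ in 𝓝[>] 0, lam (x + t • d) j = 0 := by
    intro hev
    obtain ⟨ε, hε, hsub⟩ := mem_nhdsGT_iff_exists_Ioo_subset.1 hev
    refine hj (mem_weaklyActivePos.2 ⟨hjw, ε, hε, fun t ht0 ht => ?_⟩)
    have hne : lam (x + t • d) j ≠ 0 := hsub ⟨ht0, ht⟩
    exact ⟨(mul_eq_zero.1 ((hk _).2.2.2.2 j)).resolve_left hne,
      lt_of_le_of_ne ((hk _).2.2.2.1 j) hne.symm⟩
  have hlim : Tendsto (fun t : ℝ => t⁻¹ * (lam (x + t • d) j - lam x j)) (𝓝[>] 0)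
      (𝓝 (w.2.1 j)) :=
    ((EuclideanSpace.proj j : EuclideanSpace ℝ (Fin m) →L[ℝ] ℝ).continuous.tendsto _).comp
      (Tendsto.fst_nhds (Tendsto.snd_nhds hw))
  refine isClosed_singleton.mem_of_frequently_of_tendsto (s := {(0 : ℝ)}) (hfreq.mono ?_) hlim
  intro t ht
  simp [ht, hl0]

/-- Continuous differentiability of the primal-dual solution under strict complementarity. -/
theorem contDiffAt_of_SCSC (h : P.IsC2) (hμ : 0 < μ) (hc : P.IsStronglyConvexProgram μ)
    (hz : Continuous z) (hk : ∀ x, P.IsKKT x (z x).1 (z x).2.1 (z x).2.2)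
    (hl : P.LICQ x (z x).1) (hsc : P.SCSC x (z x).1 (z x).2.1) : ContDiffAt ℝ 1 z x := by
  classical
  set J := P.active x (z x).1 with hJ
  -- The active set at `x` is frozen: the equation is `p_j = 0` for active `j` and `lam_j = 0`
  -- otherwise. Keeping `x` as a component makes the system square, so the inverse function theorem
  -- suffices.
  let F : EuclideanSpace ℝ (Fin dx) ×
        (EuclideanSpace ℝ (Fin dy) × EuclideanSpace ℝ (Fin m) × EuclideanSpace ℝ (Fin n)) →
      EuclideanSpace ℝ (Fin dx) × (EuclideanSpace ℝ (Fin dy) × (Fin m → ℝ) × (Fin n → ℝ)) :=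
    fun w => (w.1, P.gradLagrangian w.1 w.2.1 w.2.2.1 w.2.2.2,
      (fun j => if j ∈ J then P.p j w.1 w.2.1 else w.2.2.1 j), fun i => P.q i w.1 w.2.1)
  have hpair : ContDiff ℝ 1 fun w : EuclideanSpace ℝ (Fin dx) ×
        (EuclideanSpace ℝ (Fin dy) × EuclideanSpace ℝ (Fin m) × EuclideanSpace ℝ (Fin n)) =>
      (w.1, w.2.1) := by fun_prop
  have hF : ContDiff ℝ 1 F := by
    refine contDiff_fst.prodMk ((contDiff_gradLagrangian h).prodMk (ContDiff.prodMk ?_ ?_))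
    · refine contDiff_pi.2 fun j => ?_
      by_cases hj : j ∈ J
      · simp only [hj, if_true]
        exact ((h.2.1 j).of_le one_le_two).comp hpair
      · simp only [hj, if_false]
        fun_prop
    · exact contDiff_pi.2 fun i => ((h.2.2 i).of_le one_le_two).comp hpair
  let π : EuclideanSpace ℝ (Fin dx) ×
        (EuclideanSpace ℝ (Fin dy) × EuclideanSpace ℝ (Fin m) × EuclideanSpace ℝ (Fin n)) →L[ℝ]
      EuclideanSpace ℝ (Fin dx) × EuclideanSpace ℝ (Fin dy) :=
    (ContinuousLinearMap.fst ℝ _ _).prod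
      ((ContinuousLinearMap.fst ℝ _ _).comp (ContinuousLinearMap.snd ℝ _ _))
  let ρ : Fin m → EuclideanSpace ℝ (Fin dx) ×
        (EuclideanSpace ℝ (Fin dy) × EuclideanSpace ℝ (Fin m) × EuclideanSpace ℝ (Fin n)) →L[ℝ] ℝ :=
    fun j => (EuclideanSpace.proj j : EuclideanSpace ℝ (Fin m) →L[ℝ] ℝ).comp
      ((ContinuousLinearMap.fst ℝ _ _).comp
        ((ContinuousLinearMap.snd ℝ _ _).comp (ContinuousLinearMap.snd ℝ _ _)))
  let F' := (ContinuousLinearMap.fst ℝ (EuclideanSpace ℝ (Fin dx))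
      (EuclideanSpace ℝ (Fin dy) × EuclideanSpace ℝ (Fin m) × EuclideanSpace ℝ (Fin n))).prod
    ((P.derivGrad x (z x).1 (z x).2.1 (z x).2.2).prod
      ((ContinuousLinearMap.pi fun j => if j ∈ J then (P.derivP j x (z x).1).comp π else ρ j).prod
        (ContinuousLinearMap.pi fun i => (P.derivQ i x (z x).1).comp π)))
  have hF' : HasFDerivAt F F' (x, z x) := by
    refine hasFDerivAt_fst.prodMk ((hasFDerivAt_gradLagrangian h).prodMk
      (HasFDerivAt.prodMk ?_ ?_))
    · refine hasFDerivAt_pi.2 fun j => ?_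
      by_cases hj : j ∈ J
      · simp only [hj, if_true]
        exact (h.differentiableAt_p j (x, (z x).1)).hasFDerivAt.comp (f := π) (x, z x) π.hasFDerivAt
      · simp only [hj, if_false]
        exact (ρ j).hasFDerivAt
    · exact hasFDerivAt_pi.2 fun i =>
        (h.differentiableAt_q i (x, (z x).1)).hasFDerivAt.comp (f := π) (x, z x) π.hasFDerivAt
  have hinj : Function.Injective F' := by
    rw [injective_iff_map_eq_zero]
    rintro ⟨d, u, om⟩ h0
    have h1 : d = 0 := congrArg Prod.fst h0
    subst h1
    have h2 : P.derivGrad x (z x).1 (z x).2.1 (z x).2.2 (0, (u, om)) = 0 :=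
      congrArg (fun v => v.2.1) h0
    have h3 : ∀ j, (if j ∈ J then (P.derivP j x (z x).1).comp π else ρ j) (0, (u, om)) = 0 :=
      fun j => congrArg (fun v => v.2.2.1 j) h0
    have h4 : ∀ i, P.derivQ i x (z x).1 (0, u) = 0 := fun i => congrArg (fun v => v.2.2.2 i) h0
    have h5 : ∀ j ∉ J, om.1 j = 0 := fun j hj => by
      have := h3 j
      rw [if_neg hj] at this
      exact this
    obtain ⟨rfl, rfl⟩ := hl.eq_zero_of_derivGrad h hμ hc (hk x).2.2.2.1 h5 h2 (fun j => by
        by_cases hj : j ∈ J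
        · have h6 := h3 j
          rw [if_pos hj] at h6
          have h6 : P.derivP j x (z x).1 (0, u) = 0 := h6
          rw [derivP_apply h, inner_zero_right, zero_add] at h6
          rw [h6, mul_zero]
        · rw [h5 j hj, zero_mul])
      (fun i => by
        have h6 := h4 i
        rwa [derivQ_apply h, inner_zero_right, zero_add] at h6)
    rfl
  -- Strict complementarity enters here: positive multipliers stay positive and keep their
  -- constraints active, while inactive constraints stay inactive and keep their multipliers zero.
  have hval : ∀ᶠ x' in 𝓝 x, F (x', z x') = (x', 0, 0, 0) := by
    have hcomp : ∀ᶠ x' in 𝓝 x, ∀ j, (if j ∈ J then P.p j x' (z x').1 else (z x').2.1 j) = 0 := by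
      refine eventually_all.2 fun j => ?_
      by_cases hj : j ∈ J
      · have h1 : Tendsto (fun x' => (z x').2.1 j) (𝓝 x) (𝓝 ((z x).2.1 j)) :=
          ((EuclideanSpace.proj j : EuclideanSpace ℝ (Fin m) →L[ℝ] ℝ).continuous.tendsto _).comp
            hz.continuousAt.snd.fst
        filter_upwards [h1.eventually_ne (hsc j hj).ne'] with x' hx'
        rw [if_pos hj]
        exact (mul_eq_zero.1 ((hk x').2.2.2.2 j)).resolve_left hx'
      · have h1 : Tendsto (fun x' => P.p j x' (z x').1) (𝓝 x) (𝓝 (P.p j x (z x).1)) :=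
          ((h.2.1 j).continuous.tendsto (x, (z x).1)).comp
            (tendsto_id.prodMk_nhds hz.continuousAt.fst)
        filter_upwards [h1.eventually_ne fun h => hj (mem_active.2 h)] with x' hx'
        rw [if_neg hj]
        exact (hk x').eq_zero_of_notMem_active fun h => hx' (mem_active.1 h)
    filter_upwards [hcomp] with x' hx'
    exact Prod.ext rfl (Prod.ext (hk x').1 (Prod.ext (funext hx') (funext (hk x').2.2.1)))
  have hcurve : ContDiffAt ℝ 1 (fun x' => (x', z x')) x :=
    ContDiffAt.of_comp_of_injective hF.contDiffAt hF' hinj (by simp)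
      (continuousAt_id.prodMk hz.continuousAt) (contDiffAt_id.prodMk contDiffAt_const) hval
  exact hcurve.snd

end Path

end ParamProgram

theorem HasFDerivAt.hasDirDeriv {X Y : Type*} [NormedAddCommGroup X] [NormedSpace ℝ X]
    [NormedAddCommGroup Y] [NormedSpace ℝ Y] {F : X → Y} {F' : X →L[ℝ] Y} {x : X}
    (hF : HasFDerivAt F F' x) (d : X) : HasDirDeriv F x d (F' d) :=
  (hF.hasLineDerivAt d).tendsto_slope_zero_right

end

/-! ### The sensitivity theorem for the parametric program. -/

theorem theorem1 {dx dy m n : ℕ} (P : ParamProgram dx dy m n) (μ : ℝ) (hμ : 0 < μ)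
    (hC2 : P.IsC2)
    (hconv : P.IsStronglyConvexProgram μ)
    (hfeas : ∀ x, (P.feasible x).Nonempty)
    (hLICQ : ∀ x y, P.IsSolution x y → P.LICQ x y) :
    ∃ (ystar : EuclideanSpace ℝ (Fin dx) → EuclideanSpace ℝ (Fin dy))
      (lam : EuclideanSpace ℝ (Fin dx) → EuclideanSpace ℝ (Fin m))
      (nu : EuclideanSpace ℝ (Fin dx) → EuclideanSpace ℝ (Fin n))
      (z : EuclideanSpace ℝ (Fin dx) →
        EuclideanSpace ℝ (Fin dy) × EuclideanSpace ℝ (Fin m) × EuclideanSpace ℝ (Fin n)),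
      (∀ x, z x = (ystar x, lam x, nu x)) ∧
      -- (i) existence and uniqueness of the solution and of the multipliers
      (∀ x, P.IsSolution x (ystar x) ∧ ∀ y, P.IsSolution x y → y = ystar x) ∧
      (∀ x, P.IsKKT x (ystar x) (lam x) (nu x) ∧
        ∀ lam' nu', P.IsKKT x (ystar x) lam' nu' → lam' = lam x ∧ nu' = nu x) ∧
      -- (ii) continuity and local Lipschitz continuity
      Continuous z ∧ LocallyLipschitz z ∧
      -- (iii) directional derivatives
      (∀ x d : EuclideanSpace ℝ (Fin dx), ∀ S : Finset (Fin m),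
        S = P.strictlyActive x (ystar x) (lam x) ∪ P.weaklyActivePos ystar lam x d →
        IsUnit (P.kktM S x (ystar x) (lam x) (nu x)) ∧
        ∃ z' : EuclideanSpace ℝ (Fin dy) × EuclideanSpace ℝ (Fin m) × EuclideanSpace ℝ (Fin n),
          HasDirDeriv z x d z' ∧
          reducedVec S z' =
            (-((P.kktM S x (ystar x) (lam x) (nu x))⁻¹ *
              P.kktN S x (ystar x) (lam x) (nu x))).mulVec d.ofLp ∧
          (∀ j ∈ P.weaklyActiveNeg ystar lam x d, z'.2.1 j = 0) ∧
          (∀ j ∉ P.active x (ystar x), z'.2.1 j = 0)) ∧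
      -- (iv) continuous differentiability under strict complementarity
      (∀ x : EuclideanSpace ℝ (Fin dx), P.SCSC x (ystar x) (lam x) →
        ContDiffAt ℝ 1 z x ∧
        ∀ S : Finset (Fin m), S = P.strictlyActive x (ystar x) (lam x) →
          S = P.active x (ystar x) ∧
          IsUnit (P.kktM S x (ystar x) (lam x) (nu x)) ∧
          ∀ d : EuclideanSpace ℝ (Fin dx),
            reducedVec S (fderiv ℝ z x d) =
              (-((P.kktM S x (ystar x) (lam x) (nu x))⁻¹ *
                P.kktN S x (ystar x) (lam x) (nu x))).mulVec d.ofLp ∧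
            (∀ j ∉ P.active x (ystar x), (fderiv ℝ z x d).2.1 j = 0)) := by
  choose ystar hsol using fun x => ParamProgram.exists_isSolution hC2 hμ hconv (hfeas x)
  have hl : ∀ x, P.LICQ x (ystar x) := fun x => hLICQ x _ (hsol x)
  choose lam nu hk using fun x => (hsol x).exists_isKKT hC2 hconv (hl x)
  have hLip : LocallyLipschitz fun x => (ystar x, lam x, nu x) :=
    ParamProgram.locallyLipschitz_of_isKKT (om := fun x => (lam x, nu x)) hC2 hμ hconv hsol hl hk
  have hdir : ∀ x d : EuclideanSpace ℝ (Fin dx), ∀ S : Finset (Fin m),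
      S = P.strictlyActive x (ystar x) (lam x) ∪ P.weaklyActivePos ystar lam x d →
      IsUnit (P.kktM S x (ystar x) (lam x) (nu x)) ∧
      ∃ z' : EuclideanSpace ℝ (Fin dy) × EuclideanSpace ℝ (Fin m) × EuclideanSpace ℝ (Fin n),
        HasDirDeriv (fun x => (ystar x, lam x, nu x)) x d z' ∧
        reducedVec S z' =
          (-((P.kktM S x (ystar x) (lam x) (nu x))⁻¹ *
            P.kktN S x (ystar x) (lam x) (nu x))).mulVec d.ofLp ∧
        (∀ j ∈ P.weaklyActiveNeg ystar lam x d, z'.2.1 j = 0) ∧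
        (∀ j ∉ P.active x (ystar x), z'.2.1 j = 0) := by
    intro x d S hS
    have hunit : IsUnit (P.kktM S x (ystar x) (lam x) (nu x)) := by
      refine ParamProgram.isUnit_kktM hC2 hμ hconv (hl x) (hk x).2.2.2.1 fun j hj => ?_
      rw [hS, Finset.mem_union] at hj
      rcases hj with hj | hj
      · exact (ParamProgram.mem_strictlyActive.1 hj).1
      · exact (ParamProgram.mem_weaklyActive.1 (ParamProgram.mem_weaklyActivePos.1 hj).1).1
    obtain ⟨w, hw⟩ := ParamProgram.exists_hasDirDeriv (x := x) hC2 hμ hconv hLip hk (hl x) d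
    have hcont := hLip.continuous.continuousAt (x := x)
    have hlin := ParamProgram.isLinearizedKKT_of_tendsto hC2 hcont hk le_rfl hw
    have hneg : ∀ j ∈ P.weaklyActiveNeg ystar lam x d, w.2.1 j = 0 := fun j hj =>
      ParamProgram.eq_zero_of_mem_weaklyActiveNeg rfl hk hw hj
    refine ⟨hunit, w, hw, ?_, hneg, hlin.inactive⟩
    -- An index off `S` is inactive or in `J⁰₋`, and in both cases the multiplier derivative is
    -- zero; on `S` the derivative of `p_j` along the path is zero. So the complementarity system
    -- reduces to a linear one.
    refine ParamProgram.reducedVec_eq (u := w.1) (om := w.2) hC2 hunit (fun j hj => ?_)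
      hlin.stationary (fun j hj => ?_) hlin.equality
    · rw [hS, Finset.mem_union, not_or] at hj
      by_cases hja : j ∈ P.active x (ystar x)
      · exact hneg j (Finset.mem_sdiff.2 ⟨Finset.mem_sdiff.2 ⟨hja, hj.1⟩, hj.2⟩)
      · exact hlin.inactive j hja
    · rw [hS, Finset.mem_union] at hj
      rcases hj with hj | hj
      · exact hlin.strictlyActive j hj
      · exact ParamProgram.derivP_eq_zero_of_mem_weaklyActivePos hC2 hcont rfl hw hj
  refine ⟨ystar, lam, nu, fun x => (ystar x, lam x, nu x), fun _ => rfl,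
    fun x => ⟨hsol x, fun y hy => (hk x).eq_of_isSolution hC2 hμ hconv hy⟩,
    fun x => ⟨hk x, fun lam' nu' hk' => (hk x).multipliers_unique hC2 (hl x) hk'⟩,
    hLip.continuous, hLip, hdir, fun x hsc => ?_⟩
  have hcd : ContDiffAt ℝ 1 (fun x => (ystar x, lam x, nu x)) x :=
    ParamProgram.contDiffAt_of_SCSC hC2 hμ hconv hLip.continuous hk (hl x) hsc
  have hact : P.strictlyActive x (ystar x) (lam x) = P.active x (ystar x) :=
    Finset.ext fun j => ParamProgram.mem_strictlyActive.trans ⟨And.left, fun hj => ⟨hj, hsc j hj⟩⟩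
  -- Strict complementarity empties `J⁰`, so the set `S` of the directional formula is `J⁺` for
  -- every `d`, and the Fréchet derivative can be read off direction by direction.
  have hpos : ∀ d, P.weaklyActivePos ystar lam x d = ∅ := fun d =>
    Finset.eq_empty_of_forall_notMem fun j hj => by
      have := ParamProgram.mem_weaklyActive.1 (ParamProgram.mem_weaklyActivePos.1 hj).1
      exact this.2 (hsc j this.1)
  refine ⟨hcd, fun S hS => ?_⟩
  have hdirS := fun d => hdir x d S (by rw [hpos, Finset.union_empty, hS])
  refine ⟨hS.trans hact, (hdirS 0).1, fun d => ?_⟩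
  obtain ⟨-, w, hw, hred, -, hin⟩ := hdirS d
  have hderiv : HasDirDeriv (fun x => (ystar x, lam x, nu x)) x d
      (fderiv ℝ (fun x => (ystar x, lam x, nu x)) x d) :=
    (hcd.differentiableAt one_ne_zero).hasFDerivAt.hasDirDeriv d
  rw [tendsto_nhds_unique hderiv hw]
  exact ⟨hred, hin⟩
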